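/- **Cayley-Hamilton-Newton theorem.** Let $K$ be a field, let $V$ be a finite-dimensional $K$-vector space with a fixed basis, and let $q\in K$, $q\neq 0$. Put $k_q:=q^{k-1}+q^{k-3}+\dots+q^{1-k}$ (which is $(q^k-q^{-k})/(q-q^{-1})$ if $q^2\ne1$) and assume $k_q\neq 0$ for all $k\ge 1$. For an operator $X$ on $V\otimes V$, let $X_j$ denote $X$ acting in the $j$-th and $(j+1)$-st factors of $V^{\otimes m}$. Let $\hat R,\hat F\in\mathrm{Aut}(V\otimes V)$ satisfy the following conditions. * $\hat R$ and $\hat F$ are compatible R-matrices: $\hat R_1\hat R_2\hat R_1=\hat R_2\hat R_1\hat R_2$, $\hat F_1\hat F_2\hat F_1=\hat F_2\hat F_1\hat F_2$, $\hat R_1\hat F_2\hat F_1=\hat F_2\hat F_1\hat R_2$ and $\hat F_1\hat F_2\hat R_1=\hat R_2\hat F_1\hat F_2$. * $\hat R$ is an even Hecke R-matrix: $\hat R^2=I+(q-q^{-1})\hat R$, and for some $n\ge 1$ one has $A^{(n+1)}=0$ and $\operatorname{rank}A^{(n)}=1$. Here the $q$-antisymmetrizers $A^{(k)}$ and $q$-symmetrizers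 $S^{(k)}$ in $\mathrm{End}(V^{\otimes k})$ are given by $A^{(1)}=S^{(1)}=I$ and, for $k\ge2$, $$A^{(k)}=\tfrac1{k_q}A^{(k-1)}\bigl(q^{k-1}-(k-1)_q\hat R_{k-1}\bigr)A^{(k-1)},\qquad S^{(k)}=\tfrac1{k_q}S^{(k-1)}\bigl(q^{1-k}+(k-1)_q\hat R_{k-1}\bigr)S^{(k-1)}.$$ * $\hat F$ is closed: there is a (necessarily unique) $\Psi$ with $\sum_{f,g}\Psi^{af}_{cg}\hat F^{gb}_{fd}=\delta^a_d\delta^b_c$, where upper indices number rows and lower indices number columns. Put $D^a_b:=\sum_c\Psi^{ac}_{bc}$. For an operator $X$ on $V^{\otimes k}$ whose entries lie in a (possibly noncommutative) $K$-algebra, define the quantum trace over a set of factors by $\mathrm{Tr}_{\hat F(i,\dots,k)}X:=\mathrm{Tr}_{(i,\dots,k)}(D_i\cdots D_kX)$, where $D_j$ is $D$ acting in the $j$-th factor and $\mathrm{Tr}_{(i,\dots,k)}$ is the ordinary partial trace over the factors $i,\dots,k$. For a matrix $M$, with entries in such an algebra, put $M_{\overline 1}:=M_1$ ($M$ acting in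 the first factor) and $M_{\overline{k+1}}:=\hat F_kM_{\overline k}\hat F_k^{-1}$. Put $\hat R^{\hat F}:=\hat F\hat R\hat F^{-1}$ and $\hat R^{\hat F\hat F}:=(\hat R^{\hat F})^{\hat F}$. Let $\mathcal M(\hat R,\hat F)$ be the unital associative $K$-algebra generated by the components of a matrix $M$ subject to the relation $$\hat R_1M_{\overline1}M_{\overline2}=M_{\overline1}M_{\overline2}\,\hat R^{\hat F\hat F}_1 .$$ For $k\ge1$ put $\hat R_{1\to k-1}:=\hat R_1\hat R_2\cdots\hat R_{k-1}$ (the identity for $k=1$) and $$M^{\overline k}:=\mathrm{Tr}_{\hat F(2,\dots,k)}(\hat R_{1\to k-1}M_{\overline1}\cdots M_{\overline k}),$$ $$M^{\wedge k}:=\mathrm{Tr}_{\hat F(2,\dots,k)}(A^{(k)}M_{\overline1}\cdots M_{\overline k}),\qquad M^{\mathcal S k}:=\mathrm{Tr}_{\hat F(2,\dots,k)}(S^{(k)}M_{\overline1}\cdots M_{\overline k}),$$ $$\sigma_k(M):=\mathrm{Tr}_{\hat F(1,\dots,k)}(A^{(k)}M_{\overline1}\cdots M_{\overline k}),\qquad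 \tau_k(M):=\mathrm{Tr}_{\hat F(1,\dots,k)}(S^{(k)}M_{\overline1}\cdots M_{\overline k}),$$ and $\sigma_0(M)=\tau_0(M)=1$. Then for the matrix $M$ of generators of $\mathcal M(\hat R,\hat F)$ and every $k\ge 1$ the following matrix identities hold: $$(-1)^{k-1}k_q\,M^{\wedge k}=\sum_{i=0}^{k-1}(-q)^i\,M^{\overline{k-i}}\,\sigma_i(M),\qquad k_q\,M^{\mathcal S k}=\sum_{i=0}^{k-1}q^{-i}\,M^{\overline{k-i}}\,\tau_i(M),$$ where every entry of $M^{\overline{k-i}}$ is multiplied on the right by $\sigma_i(M)$, respectively $\tau_i(M)$. -/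

import Mathlib

/-!
Matrix conventions: `K` is the ground field, `V = K^ι` for a finite index type `ι`, and an
operator on the tensor power of `m` copies of `V`, with entries in a (not necessarily commutative)
`K`-algebra `S`, is a matrix whose rows (upper indices) and columns (lower indices) are
indexed by `Fin m → ι`.
An operator `X` on `V ⊗ V` with components `X^{ab}_{cd}` is the matrix `X (a, b) (c, d)`.
-/

namespace QMA

section Embeddings

variable {ι S : Type*} [DecidableEq ι] [Semiring S]

/-- `X ⊗ I`: an operator on the first `m` factors acting on `m + 1` factors. -/
def extendRight {m : ℕ} (X : Matrix (Fin m → ι) (Fin m → ι) S) :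
    Matrix (Fin (m + 1) → ι) (Fin (m + 1) → ι) S :=
  Matrix.of fun a b =>
    if a (Fin.last m) = b (Fin.last m) then X (Fin.init a) (Fin.init b) else 0

/-- The matrix `M_1`: the matrix `M` acting in the first of `m + 1` factors. -/
def inFirst {m : ℕ} (M : Matrix ι ι S) : Matrix (Fin (m + 1) → ι) (Fin (m + 1) → ι) S :=
  Matrix.of fun a b => if ∀ l, l ≠ 0 → a l = b l then M (a 0) (b 0) else 0

/-- The operator `X_j`: an operator `X` on `V ⊗ V` acting in two neighbouring factors out of
`m + 1`. The position `j : Fin m` counts from `0`, so that `inPair X j` acts in the factors with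
the (zero-based) numbers `j` and `j + 1`. -/
def inPair {m : ℕ} (X : Matrix (ι × ι) (ι × ι) S) (j : Fin m) :
    Matrix (Fin (m + 1) → ι) (Fin (m + 1) → ι) S :=
  Matrix.of fun a b =>
    if ∀ l, l ≠ j.castSucc → l ≠ j.succ → a l = b l then
      X (a j.castSucc, a j.succ) (b j.castSucc, b j.succ)
    else 0

end Embeddings

section RMatrices

variable {K ι : Type*} [Field K] [Fintype ι] [DecidableEq ι]

/-- An R-matrix: an automorphism `X` of `V ⊗ V` with `X_1 X_2 X_1 = X_2 X_1 X_2` on `V ⊗ V ⊗ V`. -/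
structure IsRMatrix (X : Matrix (ι × ι) (ι × ι) K) : Prop where
  isUnit : IsUnit X
  braid : inPair X (0 : Fin 2) * inPair X (1 : Fin 2) * inPair X (0 : Fin 2) =
    inPair X (1 : Fin 2) * inPair X (0 : Fin 2) * inPair X (1 : Fin 2)

/-- Compatibility of two R-matrices: `R_1 F_2 F_1 = F_2 F_1 R_2` and `F_1 F_2 R_1 = R_2 F_1 F_2`. -/
structure IsCompatible (R F : Matrix (ι × ι) (ι × ι) K) : Prop where
  left_isRMatrix : IsRMatrix R
  right_isRMatrix : IsRMatrix F
  compat₁ : inPair R (0 : Fin 2) * inPair F (1 : Fin 2) * inPair F (0 : Fin 2) =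
    inPair F (1 : Fin 2) * inPair F (0 : Fin 2) * inPair R (1 : Fin 2)
  compat₂ : inPair F (0 : Fin 2) * inPair F (1 : Fin 2) * inPair R (0 : Fin 2) =
    inPair R (1 : Fin 2) * inPair F (0 : Fin 2) * inPair F (1 : Fin 2)

/-- The `q`-number `k_q = (q^k - q^{-k}) / (q - q^{-1})`, written as the Laurent polynomial
`q^{k-1} + q^{k-3} + ... + q^{1-k}`, so that it also makes sense (as the limit) at `q = ±1`. -/
def qNumber (q : K) (k : ℕ) : K :=
  ∑ j ∈ Finset.range k, q ^ (k - 1 - j) * q⁻¹ ^ j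

theorem qNumber_eq (q : K) (hq : q ≠ q⁻¹) (k : ℕ) :
    qNumber q k = (q ^ k - q⁻¹ ^ k) / (q - q⁻¹) := by
  rw [eq_div_iff (sub_ne_zero.mpr hq), qNumber, ← (Commute.all q q⁻¹).geom_sum₂_mul]
  congr 1
  rw [← Finset.sum_range_reflect]
  refine Finset.sum_congr rfl fun j hj => ?_
  have := Finset.mem_range.mp hj
  congr 2
  omega

/-- The `q`-antisymmetrizer `A^{(k)}` on `k` factors: `A^{(1)} = I` and
`A^{(k)} = (1/k_q) A^{(k-1)} (q^{k-1} - (k-1)_q R_{k-1}) A^{(k-1)}`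
(the value at `k = 0` is the identity). -/
def antisymmetrizer (q : K) (R : Matrix (ι × ι) (ι × ι) K) :
    (k : ℕ) → Matrix (Fin k → ι) (Fin k → ι) K
  | 0 => 1
  | 1 => 1
  | m + 2 =>
    (qNumber q (m + 2))⁻¹ • (extendRight (antisymmetrizer q R (m + 1)) *
      (q ^ (m + 1) • 1 - qNumber q (m + 1) • inPair R (Fin.last m)) *
      extendRight (antisymmetrizer q R (m + 1)))

/-- The `q`-symmetrizer `S^{(k)}` on `k` factors: `S^{(1)} = I` and
`S^{(k)} = (1/k_q) S^{(k-1)} (q^{1-k} + (k-1)_q R_{k-1}) S^{(k-1)}`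
(the value at `k = 0` is the identity). -/
def symmetrizer (q : K) (R : Matrix (ι × ι) (ι × ι) K) :
    (k : ℕ) → Matrix (Fin k → ι) (Fin k → ι) K
  | 0 => 1
  | 1 => 1
  | m + 2 =>
    (qNumber q (m + 2))⁻¹ • (extendRight (symmetrizer q R (m + 1)) *
      (q⁻¹ ^ (m + 1) • 1 + qNumber q (m + 1) • inPair R (Fin.last m)) *
      extendRight (symmetrizer q R (m + 1)))

/-- A Hecke R-matrix with parameter `q`, all of whose `q`-numbers `k_q`, `k ≥ 1`, are nonzero. -/
structure IsHecke (q : K) (R : Matrix (ι × ι) (ι × ι) K) : Prop where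
  isRMatrix : IsRMatrix R
  hecke : R * R = 1 + (q - q⁻¹) • R
  q_ne_zero : q ≠ 0
  qNumber_ne_zero : ∀ k : ℕ, 1 ≤ k → qNumber q k ≠ 0

/-- An even Hecke R-matrix of height `n`: `A^{(n+1)} = 0` and `rank A^{(n)} = 1`. -/
structure IsEvenHecke (q : K) (R : Matrix (ι × ι) (ι × ι) K) (n : ℕ) : Prop where
  isHecke : IsHecke q R
  height_pos : 1 ≤ n
  antisymmetrizer_eq_zero : antisymmetrizer q R (n + 1) = 0
  rank_antisymmetrizer : (antisymmetrizer q R n).rank = 1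

/-- `Ψ` inverts `F` in the indices `(a, c)`:
`∑_{f,g} Ψ^{af}_{cg} F^{gb}_{fd} = δ^a_d δ^b_c`. Such a `Ψ` is unique. -/
def IsSkewInverse (F Ψ : Matrix (ι × ι) (ι × ι) K) : Prop :=
  ∀ a b c d : ι, ∑ f, ∑ g, Ψ (a, f) (c, g) * F (g, b) (f, d) = if a = d ∧ b = c then 1 else 0

/-- A closed R-matrix: an (invertible) R-matrix that is also invertible in the indices `(a, c)`. -/
structure IsClosedRMatrix (F : Matrix (ι × ι) (ι × ι) K) : Prop where
  isRMatrix : IsRMatrix F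
  exists_skewInverse : ∃ Ψ, IsSkewInverse F Ψ

/-- The matrix `D^a_b = ∑_c Ψ^{ac}_{bc}`. -/
def traceMatrix (Ψ : Matrix (ι × ι) (ι × ι) K) : Matrix ι ι K :=
  Matrix.of fun a b => ∑ c, Ψ (a, c) (b, c)

/-- The twist `R^F = F R F^{-1}`. -/
noncomputable def twist (R F : Matrix (ι × ι) (ι × ι) K) : Matrix (ι × ι) (ι × ι) K :=
  F * R * F⁻¹

end RMatrices

section Traces

variable {K ι S : Type*} [Field K] [Fintype ι] [DecidableEq ι] [Ring S] [Algebra K S]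

/-- The quantum trace over all `m` factors, `Tr_{(1...m)} (D_1 ... D_m X)`. -/
def qTrace (D : Matrix ι ι K) {m : ℕ} (X : Matrix (Fin m → ι) (Fin m → ι) S) : S :=
  ∑ a : Fin m → ι, ∑ b : Fin m → ι, (∏ l, D (a l) (b l)) • X b a

/-- The quantum trace over all factors but the first,
`Tr_{(2...m+1)} (D_2 ... D_{m+1} X)`, a matrix on the first factor. -/
def qTraceTail (D : Matrix ι ι K) {m : ℕ} (X : Matrix (Fin (m + 1) → ι) (Fin (m + 1) → ι) S) :
    Matrix ι ι S :=
  Matrix.of fun x y =>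
    ∑ a : Fin m → ι, ∑ b : Fin m → ι,
      (∏ l, D (a l) (b l)) • X (Fin.cons x b : Fin (m + 1) → ι) (Fin.cons y a : Fin (m + 1) → ι)

/-- An operator with entries in `K`, viewed as an operator with entries in `S`. -/
def lift (S : Type*) [Ring S] [Algebra K S] {α : Type*} (X : Matrix α α K) : Matrix α α S :=
  X.map (algebraMap K S)

/-- The matrix copies on `m + 1` factors, `M_{\bar 1} = M_1` and
`M_{\overline{k+1}} = F_k M_{\bar k} F_k^{-1}` (positions count from `0`). -/
noncomputable def copy (F : Matrix (ι × ι) (ι × ι) K) (M : Matrix ι ι S) {m : ℕ}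
    (j : Fin (m + 1)) : Matrix (Fin (m + 1) → ι) (Fin (m + 1) → ι) S :=
  Fin.induction (motive := fun _ => Matrix (Fin (m + 1) → ι) (Fin (m + 1) → ι) S)
    (inFirst M) (fun i X => lift S (inPair F i) * X * lift S (inPair F⁻¹ i)) j

/-- The ordered product `M_{\bar 1} M_{\bar 2} ... M_{\overline{m+1}}` on `m + 1` factors. -/
noncomputable def copyProd (F : Matrix (ι × ι) (ι × ι) K) (M : Matrix ι ι S) (m : ℕ) :
    Matrix (Fin (m + 1) → ι) (Fin (m + 1) → ι) S :=
  (List.ofFn fun j : Fin (m + 1) => copy F M j).prod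

/-- `R_{1 → m} = R_1 R_2 ... R_m` on `m + 1` factors (the identity for `m = 0`). -/
def rChain (R : Matrix (ι × ι) (ι × ι) K) (m : ℕ) :
    Matrix (Fin (m + 1) → ι) (Fin (m + 1) → ι) K :=
  (List.ofFn fun j : Fin m => inPair R j).prod

/-- `σ_0(M) = 1`, `σ_k(M) = Tr_F_{(1...k)} (A^{(k)} M_{\bar 1} ... M_{\bar k})`. -/
noncomputable def sigma (q : K) (R F Ψ : Matrix (ι × ι) (ι × ι) K) (M : Matrix ι ι S) : ℕ → S
  | 0 => 1
  | m + 1 => qTrace (traceMatrix Ψ) (lift S (antisymmetrizer q R (m + 1)) * copyProd F M m)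

/-- `τ_0(M) = 1`, `τ_k(M) = Tr_F_{(1...k)} (S^{(k)} M_{\bar 1} ... M_{\bar k})`. -/
noncomputable def tau (q : K) (R F Ψ : Matrix (ι × ι) (ι × ι) K) (M : Matrix ι ι S) : ℕ → S
  | 0 => 1
  | m + 1 => qTrace (traceMatrix Ψ) (lift S (symmetrizer q R (m + 1)) * copyProd F M m)

/-- The `k`-th power `M^{\bar k} = Tr_F_{(2...k)} (R_{1 → k-1} M_{\bar 1} ... M_{\bar k})`, `k ≥ 1`
(the value `0` at `k = 0` is a placeholder). -/
noncomputable def power (R F Ψ : Matrix (ι × ι) (ι × ι) K) (M : Matrix ι ι S) :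
    ℕ → Matrix ι ι S
  | 0 => 0
  | m + 1 => qTraceTail (traceMatrix Ψ) (lift S (rChain R m) * copyProd F M m)

/-- The `k`-wedge power `M^{∧k} = Tr_F_{(2...k)} (A^{(k)} M_{\bar 1} ... M_{\bar k})`, `k ≥ 1`
(the value `0` at `k = 0` is a placeholder). -/
noncomputable def wedgePower (q : K) (R F Ψ : Matrix (ι × ι) (ι × ι) K) (M : Matrix ι ι S) :
    ℕ → Matrix ι ι S
  | 0 => 0
  | m + 1 => qTraceTail (traceMatrix Ψ) (lift S (antisymmetrizer q R (m + 1)) * copyProd F M m)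

/-- The `k`-symmetric power `M^{Sk} = Tr_F_{(2...k)} (S^{(k)} M_{\bar 1} ... M_{\bar k})`, `k ≥ 1`
(the value `0` at `k = 0` is a placeholder). -/
noncomputable def symmPower (q : K) (R F Ψ : Matrix (ι × ι) (ι × ι) K) (M : Matrix ι ι S) :
    ℕ → Matrix ι ι S
  | 0 => 0
  | m + 1 => qTraceTail (traceMatrix Ψ) (lift S (symmetrizer q R (m + 1)) * copyProd F M m)

end Traces

section TheAlgebra

variable {K ι : Type*} [Field K] [Fintype ι] [DecidableEq ι]

/-- The matrix of free generators. -/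
def freeMatrix (K ι : Type*) [Field K] : Matrix ι ι (FreeAlgebra K (ι × ι)) :=
  Matrix.of fun a b => FreeAlgebra.ι K (a, b)

/-- The defining relations, entry by entry, of
`R_1 M_{\bar 1} M_{\bar 2} = M_{\bar 1} M_{\bar 2} (R^{FF})_1` on two factors. -/
inductive Rel (R F : Matrix (ι × ι) (ι × ι) K) :
    FreeAlgebra K (ι × ι) → FreeAlgebra K (ι × ι) → Prop
  | entry (a b : Fin 2 → ι) : Rel R F
      ((lift (FreeAlgebra K (ι × ι)) (inPair R (0 : Fin 1)) *
        copy F (freeMatrix K ι) (0 : Fin 2) * copy F (freeMatrix K ι) (1 : Fin 2)) a b)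
      ((copy F (freeMatrix K ι) (0 : Fin 2) * copy F (freeMatrix K ι) (1 : Fin 2) *
        lift (FreeAlgebra K (ι × ι)) (inPair (twist (twist R F) F) (0 : Fin 1))) a b)

/-- The algebra `M(R, F)`: the unital associative `K`-algebra generated by the components of a
matrix `M` subject to `R_1 M_{\bar 1} M_{\bar 2} = M_{\bar 1} M_{\bar 2} (R^{FF})_1`. -/
abbrev Alg (R F : Matrix (ι × ι) (ι × ι) K) : Type _ := RingQuot (Rel R F)

/-- The matrix `M` of generators of `M(R, F)`. -/
noncomputable def genMatrix (R F : Matrix (ι × ι) (ι × ι) K) : Matrix ι ι (Alg R F) :=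
  (freeMatrix K ι).map (RingQuot.mkAlgHom K (Rel R F))

end TheAlgebra

end QMA

/-!
The identities are proved for any matrix `M`, over any `K`-algebra, satisfying the relation
`R_1 M_{\bar 1} M_{\bar 2} = M_{\bar 1} M_{\bar 2} R^{FF}_1`
(`qNumber_smul_wedgePower`). The substitution `q ↦ -q⁻¹` preserves the Hecke relation and turns
antisymmetrizers into symmetrizers, so the identity for the symmetric powers is an instance of the
one for the wedge powers.

All operators live in the ring of operators on `N` tensor factors. The quantum trace over a factor
is regarded as an endomorphism `X ↦ Tr_l (D_l X) ⊗ I` of this ring (`expect`, written with matrix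
units), which is linear over the operators acting trivially on the factor. It has two
properties:

* conjugation by `F_l` moves the trace: `Tr_{l+1} (D F_l X F_l⁻¹) = Tr_l (D X)`
  if `X` is trivial on the factor `l + 1` (`expect_conj_of_braid`);
* cyclicity: `Tr_{l,l+1} (D D R_l X) = Tr_{l,l+1} (D D X R^{FF}_l)`
  (`expect_expect_mul_of_braid`).

For both, the braid and compatibility relations give the identity for one particular operator on a
larger tensor power, and skew invertibility of `F` says that the slices of this operator span
everything (`unit_eq_sum_slices`).

By the first property, `σ_i(M)` may be computed in the factors `k - i + 1, …, k`, so that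
`M^{\overline{k-i}} σ_i(M) = φ(R_{1 → k-i-1} A_{k-i+1,…,k})` with
`φ(Y) = Tr_{(2…k)} (D_2 ⋯ D_k Y M_{\bar 1} ⋯ M_{\bar k})`
(`TraceTower.iterExpect_mul_sigma`). By the second property and the relation
`R_l M_{\bar 1} ⋯ M_{\bar k} = M_{\bar 1} ⋯ M_{\bar k} R^{FF}_l`, the functional `φ` satisfies
`φ(Y R_l) = φ(R_l Y)` for `l ≥ 2`. In the Hecke algebra
`(i+1)_q A_{s,…,k} = A_{s+1,…,k} (q^i - i_q R_s) A_{s+1,…,k}`, where `i = k - s`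
(`HeckeRelations.qNumber_smul_heckeAnti_succ`); together with idempotence this gives
`(i+1)_q φ(R_{1 → s-1} A_{s,…,k}) = q^i φ(R_{1 → s-1} A_{s+1,…,k}) - i_q φ(R_{1 → s} A_{s+1,…,k})`.
Unrolling this recursion from `s = 1` gives the theorem.
-/

set_option linter.unusedSectionVars false

namespace QMA

/-! ### Matrix units and quantum traces -/

section MatrixUnits

variable {K ι H : Type*} [Field K] [Fintype ι] [DecidableEq ι] [Ring H] [Algebra K H]

/-- A system of matrix units indexed by `ι` in a ring: the images of the standard matrix units
under a unital homomorphism from the matrix ring. -/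
structure IsMatrixUnits (u : ι → ι → H) : Prop where
  mul : ∀ a b c d, u a b * u c d = if b = c then u a d else 0
  sum : ∑ a, u a a = 1

variable (K) in
/-- The operators acting trivially on the tensor factor with matrix units `u`, i.e. the
centralizer of `u`. -/
def away (u : ι → ι → H) : Subalgebra K H :=
  Subalgebra.centralizer K (Set.range fun p : ι × ι => u p.1 p.2)

theorem mem_away {u : ι → ι → H} {z : H} : z ∈ away K u ↔ ∀ a b, u a b * z = z * u a b := by
  simp only [away, Subalgebra.mem_centralizer_iff, Set.forall_mem_range, Prod.forall]

/-- The operator `X` on `V ⊗ V`, acting in the two tensor factors with matrix units `u`, `v`. -/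
def pair (u v : ι → ι → H) (X : Matrix (ι × ι) (ι × ι) K) : H :=
  ∑ a, ∑ c, ∑ b, ∑ d, X (a, b) (c, d) • (u a c * v b d)

/-- The quantum partial trace over the tensor factor with matrix units `u`, tensored with the
identity of that factor, so that it is an endomorphism of the ring of all operators. -/
def expect (u : ι → ι → H) (D : Matrix ι ι K) : H →ₗ[K] H where
  toFun z := ∑ a, ∑ b, ∑ c, D a b • (u c b * z * u a c)
  map_add' y z := by simp only [mul_add, add_mul, smul_add, Finset.sum_add_distrib]
  map_smul' s z := by
    simp only [mul_smul_comm, smul_mul_assoc, Finset.smul_sum, RingHom.id_apply, smul_comm s]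

theorem expect_apply (u : ι → ι → H) (D : Matrix ι ι K) (z : H) :
    expect u D z = ∑ a, ∑ b, ∑ c, D a b • (u c b * z * u a c) := rfl

variable {u v w t : ι → ι → H} {D : Matrix ι ι K}

theorem expect_mul_of_mem_away {y : H} (hy : y ∈ away K u) (z : H) :
    expect u D (y * z) = y * expect u D z := by
  rw [mem_away] at hy
  simp only [expect_apply, Finset.mul_sum, mul_smul_comm]
  refine Finset.sum_congr rfl fun a _ => Finset.sum_congr rfl fun b _ =>
    Finset.sum_congr rfl fun c _ => ?_
  rw [← mul_assoc, hy]
  simp only [mul_assoc]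

theorem expect_mul_of_mem_away_right {y : H} (hy : y ∈ away K u) (z : H) :
    expect u D (z * y) = expect u D z * y := by
  rw [mem_away] at hy
  simp only [expect_apply, Finset.sum_mul, smul_mul_assoc]
  refine Finset.sum_congr rfl fun a _ => Finset.sum_congr rfl fun b _ =>
    Finset.sum_congr rfl fun c _ => ?_
  simp only [mul_assoc, hy]

theorem expect_mem_away (hu : IsMatrixUnits u) (z : H) : expect u D z ∈ away K u := by
  rw [mem_away]
  intro x y
  simp only [expect_apply, Finset.sum_mul, smul_mul_assoc, Finset.mul_sum, mul_smul_comm]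
  refine Finset.sum_congr rfl fun a _ => Finset.sum_congr rfl fun b _ => ?_
  rw [← Finset.smul_sum, ← Finset.smul_sum]
  congr 1
  simp only [mul_assoc, hu.mul]
  simp only [← mul_assoc, hu.mul]
  simp

theorem expect_mem_away_of_comm (h : ∀ a b, u a b ∈ away K v) {z : H} (hz : z ∈ away K v) :
    expect u D z ∈ away K v := by
  rw [expect_apply]
  refine Subalgebra.sum_mem _ fun a _ => Subalgebra.sum_mem _ fun b _ =>
    Subalgebra.sum_mem _ fun c _ => Subalgebra.smul_mem _ ?_ _
  exact mul_mem (mul_mem (h _ _) hz) (h _ _)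

theorem expect_unit (hu : IsMatrixUnits u) (a b : ι) :
    expect u D (u a b) = D b a • (1 : H) := by
  simp only [expect_apply, hu.mul, ite_mul, zero_mul, smul_ite, smul_zero]
  rw [Finset.sum_eq_single b, Finset.sum_eq_single a]
  · simp [← Finset.smul_sum, hu.sum]
  · intro e _ he
    simp [he]
  · simp
  · intro e _ he
    simp [Ne.symm he]
  · simp

theorem pair_mem_away (hu : ∀ a b, u a b ∈ away K w) (hv : ∀ a b, v a b ∈ away K w)
    (X : Matrix (ι × ι) (ι × ι) K) : pair u v X ∈ away K w :=
  Subalgebra.sum_mem _ fun _ _ => Subalgebra.sum_mem _ fun _ _ => Subalgebra.sum_mem _ fun _ _ =>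
    Subalgebra.sum_mem _ fun _ _ => Subalgebra.smul_mem _ (mul_mem (hu _ _) (hv _ _)) _

theorem mul_pair_of_mem_away {z : H} (hu : z ∈ away K u) (hv : z ∈ away K v)
    (X : Matrix (ι × ι) (ι × ι) K) : z * pair u v X = pair u v X * z := by
  rw [mem_away] at hu hv
  simp only [pair, Finset.mul_sum, Finset.sum_mul, mul_smul_comm, smul_mul_assoc]
  refine Finset.sum_congr rfl fun a _ => Finset.sum_congr rfl fun c _ =>
    Finset.sum_congr rfl fun b _ => Finset.sum_congr rfl fun d _ => ?_
  rw [mul_assoc, hv, ← mul_assoc, ← mul_assoc, hu]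

theorem unit_mem_away_comm (h : ∀ a b, u a b ∈ away K v) (a b : ι) : v a b ∈ away K u := by
  simp only [mem_away] at h ⊢
  intro c d
  rw [h]

theorem pair_one (hu : IsMatrixUnits u) (hv : IsMatrixUnits v) :
    pair u v (1 : Matrix (ι × ι) (ι × ι) K) = 1 := by
  simp only [pair, Matrix.one_apply, Prod.mk.injEq, ite_smul, one_smul, zero_smul]
  calc _ = ∑ a, ∑ b, u a a * v b b := by
        refine Finset.sum_congr rfl fun a _ => ?_
        rw [Finset.sum_eq_single a]
        · simp
        · intro b _ hb
          simp [hb.symm]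
        · simp
    _ = 1 := by rw [← Finset.sum_mul_sum, hu.sum, hv.sum, one_mul]

theorem pair_eq_sum (X : Matrix (ι × ι) (ι × ι) K) :
    pair u v X = ∑ p : ι × ι, ∑ q : ι × ι, X p q • (u p.1 q.1 * v p.2 q.2) := by
  simp only [pair, Fintype.sum_prod_type]
  exact Finset.sum_congr rfl fun a _ => Finset.sum_comm

theorem pair_mul (hu : IsMatrixUnits u) (hv : IsMatrixUnits v) (h : ∀ a b, u a b ∈ away K v)
    (X Y : Matrix (ι × ι) (ι × ι) K) : pair u v (X * Y) = pair u v X * pair u v Y := by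
  have key : ∀ p q r s : ι × ι, (u p.1 q.1 * v p.2 q.2) * (u r.1 s.1 * v r.2 s.2) =
      if q = r then u p.1 s.1 * v p.2 s.2 else 0 := by
    intro p q r s
    rw [mul_assoc, ← mul_assoc (v p.2 q.2), mem_away.1 (h r.1 s.1), mul_assoc (u r.1 s.1),
      ← mul_assoc, hu.mul, hv.mul]
    by_cases h1 : q.1 = r.1 <;> by_cases h2 : q.2 = r.2 <;> simp [h1, h2, Prod.ext_iff]
  calc pair u v (X * Y) = ∑ p : ι × ι, ∑ s : ι × ι, ∑ q : ι × ι,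
          (X p q * Y q s) • (u p.1 s.1 * v p.2 s.2) := by
        simp only [pair_eq_sum, Matrix.mul_apply, Finset.sum_smul]
    _ = ∑ p : ι × ι, ∑ q : ι × ι, ∑ r : ι × ι, ∑ s : ι × ι,
          (X p q * Y r s) • (if q = r then u p.1 s.1 * v p.2 s.2 else 0) := by
        refine Finset.sum_congr rfl fun p _ => ?_
        rw [Finset.sum_comm]
        refine Finset.sum_congr rfl fun q _ => ?_
        rw [Finset.sum_comm]
        simp
    _ = pair u v X * pair u v Y := by
        rw [pair_eq_sum, pair_eq_sum, Finset.sum_mul]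
        refine Finset.sum_congr rfl fun p _ => ?_
        rw [Finset.sum_mul]
        refine Finset.sum_congr rfl fun q _ => ?_
        rw [Finset.mul_sum]
        refine Finset.sum_congr rfl fun r _ => ?_
        rw [Finset.mul_sum]
        refine Finset.sum_congr rfl fun s _ => ?_
        rw [smul_mul_smul_comm, key]

/-- The component of `z` at the matrix unit `u a b`: an operator acting trivially on that
factor. -/
def component (u : ι → ι → H) (z : H) (a b : ι) : H := ∑ c, u c a * z * u b c

theorem component_mem_away (hu : IsMatrixUnits u) (z : H) (a b : ι) :
    component u z a b ∈ away K u := by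
  rw [mem_away]
  intro x y
  simp only [component, Finset.sum_mul, Finset.mul_sum]
  simp only [mul_assoc, hu.mul]
  simp only [← mul_assoc, hu.mul]
  simp

theorem component_mem_away_of_comm (h : ∀ a b, u a b ∈ away K v) {z : H} (hz : z ∈ away K v)
    (a b : ι) : component u z a b ∈ away K v :=
  Subalgebra.sum_mem _ fun _ _ => mul_mem (mul_mem (h _ _) hz) (h _ _)

theorem sum_unit_mul_component (hu : IsMatrixUnits u) (z : H) :
    ∑ a, ∑ b, u a b * component u z a b = z := by
  simp only [component, Finset.mul_sum]
  simp only [← mul_assoc, hu.mul]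
  simp only [ite_mul, zero_mul, Finset.sum_ite_eq, Finset.mem_univ, if_true]
  simp only [← Finset.mul_sum, ← Finset.sum_mul, hu.sum, one_mul, mul_one]

end MatrixUnits

section SkewInverse

variable {K ι H : Type*} [Field K] [Fintype ι] [DecidableEq ι] [Ring H] [Algebra K H]
  {u v : ι → ι → H} {F Ψ : Matrix (ι × ι) (ι × ι) K}

/-- The skew inverse is two-sided; summing the reversed identity gives `Tr_2 (D_2 F) = I`. -/
theorem IsSkewInverse.sum_mul_traceMatrix (h : IsSkewInverse F Ψ) (g f : ι) :
    ∑ b, ∑ d, F (g, b) (f, d) * traceMatrix Ψ d b = if g = f then 1 else 0 := by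
  let A : Matrix (ι × ι) (ι × ι) K := Matrix.of fun p q => Ψ (p.1, q.1) (p.2, q.2)
  let B : Matrix (ι × ι) (ι × ι) K := Matrix.of fun p q => F (p.2, q.2) (p.1, q.1)
  have hAB : A * B = 1 := by
    ext ⟨a, c⟩ ⟨d, b⟩
    rw [Matrix.mul_apply, Fintype.sum_prod_type, Matrix.one_apply]
    simp only [A, B, Matrix.of_apply, h a b c d, Prod.mk.injEq, eq_comm]
  have hBA : B * A = 1 := mul_eq_one_comm.1 hAB
  have hs : ∀ x, ∑ b, ∑ d, F (g, b) (f, d) * Ψ (d, x) (b, x) =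
      if f = x ∧ g = x then 1 else 0 := by
    intro x
    have := congrFun (congrFun hBA (f, g)) (x, x)
    rw [Matrix.mul_apply, Fintype.sum_prod_type, Matrix.one_apply, Finset.sum_comm] at this
    simpa only [A, B, Matrix.of_apply, Prod.mk.injEq] using this
  calc _ = ∑ x, ∑ b, ∑ d, F (g, b) (f, d) * Ψ (d, x) (b, x) := by
        simp only [traceMatrix, Matrix.of_apply, Finset.mul_sum]
        rw [Finset.sum_comm]
        refine (Finset.sum_congr rfl fun b _ => Finset.sum_comm).trans ?_
        rw [Finset.sum_comm]
        refine Finset.sum_congr rfl fun x _ => Finset.sum_comm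
    _ = _ := by
        simp only [hs]
        by_cases hgf : g = f
        · subst hgf
          simp
        · rw [if_neg hgf]
          refine Finset.sum_eq_zero fun x _ => if_neg ?_
          rintro ⟨rfl, rfl⟩
          exact hgf rfl

theorem expect_pair_eq_one (hΨ : IsSkewInverse F Ψ) (hu : IsMatrixUnits u) (hv : IsMatrixUnits v)
    (h : ∀ a b, u a b ∈ away K v) : expect v (traceMatrix Ψ) (pair u v F) = 1 := by
  simp only [pair, map_sum, map_smul, expect_mul_of_mem_away (h _ _), expect_unit hv,
    mul_smul_comm, mul_one, smul_smul]
  simp only [← Finset.sum_smul, hΨ.sum_mul_traceMatrix, ite_smul, one_smul, zero_smul]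
  simp [hu.sum]

/-- The slices of `F` in the first factor span all the operators on the second factor. -/
theorem unit_eq_sum_slices (hΨ : IsSkewInverse F Ψ) (hu : IsMatrixUnits u)
    (h : ∀ a b, u a b ∈ away K v) (a c x y : ι) :
    ∑ f, ∑ g, Ψ (a, f) (c, g) • (u x g * pair u v F * u f y) = u x y * v c a := by
  have key : ∀ f g, u x g * pair u v F * u f y =
      ∑ b, ∑ d, F (g, b) (f, d) • (u x y * v b d) := by
    intro f g
    simp only [pair, Finset.mul_sum, Finset.sum_mul, mul_smul_comm, smul_mul_assoc]
    rw [Finset.sum_eq_single g, Finset.sum_eq_single f]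
    · refine Finset.sum_congr rfl fun b _ => Finset.sum_congr rfl fun d _ => ?_
      rw [← mul_assoc, hu.mul, if_pos rfl, mul_assoc, mem_away.1 (h f y), ← mul_assoc, hu.mul,
        if_pos rfl]
    · intro e _ he
      refine Finset.sum_eq_zero fun b _ => Finset.sum_eq_zero fun d _ => ?_
      rw [← mul_assoc, hu.mul, mul_assoc, mem_away.1 (h f y), ← mul_assoc, if_pos rfl, hu.mul,
        if_neg he, zero_mul, smul_zero]
    · simp
    · intro e _ he
      refine Finset.sum_eq_zero fun k _ => Finset.sum_eq_zero fun b _ =>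
        Finset.sum_eq_zero fun d _ => ?_
      rw [← mul_assoc, hu.mul, if_neg (Ne.symm he), zero_mul, zero_mul, smul_zero]
    · simp
  simp only [key, Finset.smul_sum, smul_smul]
  calc _ = ∑ b, ∑ d, (∑ f, ∑ g, Ψ (a, f) (c, g) * F (g, b) (f, d)) • (u x y * v b d) := by
        simp only [Finset.sum_smul]
        refine (Finset.sum_congr rfl fun f _ => Finset.sum_comm).trans ?_
        rw [Finset.sum_comm]
        refine Finset.sum_congr rfl fun b _ => ?_
        refine (Finset.sum_congr rfl fun f _ => Finset.sum_comm).trans ?_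
        rw [Finset.sum_comm]
    _ = _ := by
        simp only [hΨ a _ c _, ite_smul, one_smul, zero_smul]
        rw [Finset.sum_eq_single c, Finset.sum_eq_single a]
        · simp
        · intro d _ hd
          simp [Ne.symm hd]
        · simp
        · intro b _ hb
          simp [hb]
        · simp

end SkewInverse

/-! ### Conjugation and cyclicity for the quantum trace -/

section TraceProperties

variable {K ι H : Type*} [Field K] [Fintype ι] [DecidableEq ι] [Ring H] [Algebra K H]
  {u v w t : ι → ι → H} {R F G Ψ : Matrix (ι × ι) (ι × ι) K}

/-- Conjugation by `F` moves the quantum trace to the neighbouring factor. The extra factor `u`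
serves to produce enough operators on the factor `v`: the identity holds for `F` acting
in `u`, `v` by the braid relation, and hence for all its slices. -/
theorem expect_conj_of_braid (hΨ : IsSkewInverse F Ψ) (hu : IsMatrixUnits u)
    (hv : IsMatrixUnits v) (hw : IsMatrixUnits w) (huv : ∀ a b, u a b ∈ away K v)
    (huw : ∀ a b, u a b ∈ away K w) (hvw : ∀ a b, v a b ∈ away K w)
    (hFG : F * G = 1) (hGF : G * F = 1)
    (braid : pair u v F * pair v w F * pair u v F = pair v w F * pair u v F * pair v w F)
    {z : H} (hz : z ∈ away K w) :
    expect w (traceMatrix Ψ) (pair v w F * z * pair v w G) = expect v (traceMatrix Ψ) z := by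
  set D := traceMatrix Ψ
  have hvw1 : pair v w F * pair v w G = 1 := by rw [← pair_mul hv hw hvw, hFG, pair_one hv hw]
  have huv1 : pair u v G * pair u v F = 1 := by rw [← pair_mul hu hv huv, hGF, pair_one hu hv]
  let W : Submodule K H := LinearMap.eqLocus
    (expect w D ∘ₗ LinearMap.mulRight K (pair v w G) ∘ₗ LinearMap.mulLeft K (pair v w F))
    (expect v D)
  have hW : ∀ x, x ∈ W ↔ expect w D (pair v w F * x * pair v w G) = expect v D x :=
    fun x => Iff.rfl
  have hF : pair u v F ∈ W := by
    rw [hW, expect_pair_eq_one hΨ hu hv huv]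
    calc expect w D (pair v w F * pair u v F * pair v w G)
        = expect w D (pair u v G * (pair u v F * pair v w F * pair u v F) * pair v w G) := by
          simp only [← mul_assoc, huv1, one_mul]
      _ = expect w D (pair u v G * pair v w F * pair u v F) := by
          rw [braid]
          simp only [mul_assoc, hvw1, mul_one]
      _ = 1 := by
          rw [expect_mul_of_mem_away_right (pair_mem_away huw hvw F),
            expect_mul_of_mem_away (pair_mem_away huw hvw G),
            expect_pair_eq_one hΨ hv hw hvw, mul_one, huv1]
  have hmul : ∀ x ∈ W, ∀ y ∈ away K v, y ∈ away K w → y * x ∈ W := by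
    intro x hx y hyv hyw
    rw [hW] at hx ⊢
    rw [← mul_assoc, ← mul_pair_of_mem_away hyv hyw, mul_assoc y, mul_assoc y,
      expect_mul_of_mem_away hyw, hx, expect_mul_of_mem_away hyv]
  have hmul' : ∀ x ∈ W, ∀ y ∈ away K v, y ∈ away K w → x * y ∈ W := by
    intro x hx y hyv hyw
    rw [hW] at hx ⊢
    rw [← mul_assoc, mul_assoc _ y, mul_pair_of_mem_away hyv hyw, ← mul_assoc,
      expect_mul_of_mem_away_right hyw, hx, expect_mul_of_mem_away_right hyv]
  have hunit : ∀ c a, v c a ∈ W := by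
    intro c a
    rw [← one_mul (v c a), ← hu.sum, Finset.sum_mul]
    refine Submodule.sum_mem _ fun x _ => ?_
    rw [← unit_eq_sum_slices hΨ hu huv]
    exact Submodule.sum_mem _ fun f _ => Submodule.sum_mem _ fun g _ => Submodule.smul_mem _ _
      (hmul' _ (hmul _ hF _ (huv _ _) (huw _ _)) _ (huv _ _) (huw _ _))
  rw [← hW, ← sum_unit_mul_component hv z]
  exact Submodule.sum_mem _ fun a _ => Submodule.sum_mem _ fun b _ => hmul' _ (hunit a b) _
    (component_mem_away hv z a b) (component_mem_away_of_comm hvw hz a b)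

/-- Cyclicity of the quantum trace over two neighbouring factors `w`, `t`, for `R` against
`F² R F⁻²`. With two extra factors `u`, `v` and `c = F₂ F₁ F₃ F₂`, the trace of `c` over
`w`, `t` is `F₁²`, while `R₃ c = c R₁` and `c R₃ = R₁ c`; this gives the identity for `c`, and
hence for its slices, which span all the operators on the factors `w`, `t`. -/
theorem expect_expect_mul_of_braid (hΨ : IsSkewInverse F Ψ) (hu : IsMatrixUnits u)
    (hv : IsMatrixUnits v) (hw : IsMatrixUnits w) (ht : IsMatrixUnits t)
    (huv : ∀ a b, u a b ∈ away K v)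
    (huw : ∀ a b, u a b ∈ away K w) (hut : ∀ a b, u a b ∈ away K t)
    (hvw : ∀ a b, v a b ∈ away K w) (hvt : ∀ a b, v a b ∈ away K t)
    (hwt : ∀ a b, w a b ∈ away K t)
    (hFG : F * G = 1) (hGF : G * F = 1)
    (braid₁ : pair u v F * pair v w F * pair u v F = pair v w F * pair u v F * pair v w F)
    (braid₂ : pair v w F * pair w t F * pair v w F = pair w t F * pair v w F * pair w t F)
    (left₁ : pair u v R * pair v w F * pair u v F = pair v w F * pair u v F * pair v w R)
    (left₂ : pair v w R * pair w t F * pair v w F = pair w t F * pair v w F * pair w t R)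
    (right₁ : pair u v F * pair v w F * pair u v R = pair v w R * pair u v F * pair v w F)
    (right₂ : pair v w F * pair w t F * pair v w R = pair w t R * pair v w F * pair w t F)
    (z : H) :
    expect w (traceMatrix Ψ) (expect t (traceMatrix Ψ) (pair w t R * z)) =
      expect w (traceMatrix Ψ) (expect t (traceMatrix Ψ)
        (z * pair w t (F * (F * R * G) * G))) := by
  set D := traceMatrix Ψ
  have hwv := unit_mem_away_comm hvw
  set R' := F * (F * R * G) * G with hR'
  let W : Submodule K H := LinearMap.eqLocus
    (expect w D ∘ₗ expect t D ∘ₗ LinearMap.mulLeft K (pair w t R))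
    (expect w D ∘ₗ expect t D ∘ₗ LinearMap.mulRight K (pair w t R'))
  have hW : ∀ x, x ∈ W ↔ expect w D (expect t D (pair w t R * x)) =
      expect w D (expect t D (x * pair w t R')) := fun x => Iff.rfl
  have hmul : ∀ x ∈ W, ∀ y ∈ away K w, y ∈ away K t → y * x ∈ W := by
    intro x hx y hyw hyt
    rw [hW] at hx ⊢
    rw [← mul_assoc, ← mul_pair_of_mem_away hyw hyt, mul_assoc y, mul_assoc y,
      expect_mul_of_mem_away hyt, expect_mul_of_mem_away hyw, hx,
      expect_mul_of_mem_away hyt, expect_mul_of_mem_away hyw]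
  have hmul' : ∀ x ∈ W, ∀ y ∈ away K w, y ∈ away K t → x * y ∈ W := by
    intro x hx y hyw hyt
    rw [hW] at hx ⊢
    rw [← mul_assoc, mul_assoc x, mul_pair_of_mem_away hyw hyt, ← mul_assoc x,
      expect_mul_of_mem_away_right hyt, expect_mul_of_mem_away_right hyw, hx,
      expect_mul_of_mem_away_right hyt, expect_mul_of_mem_away_right hyw]
  have hfar : ∀ X : Matrix (ι × ι) (ι × ι) K,
      pair u v F * pair w t X = pair w t X * pair u v F := fun X =>
    mul_pair_of_mem_away (pair_mem_away huw hvw F) (pair_mem_away hut hvt F) X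
  set c := pair v w F * pair u v F * pair w t F * pair v w F with hc
  have hswap : ∀ X : Matrix (ι × ι) (ι × ι) K,
      pair u v X * pair v w F * pair u v F = pair v w F * pair u v F * pair v w X →
      pair v w X * pair w t F * pair v w F = pair w t F * pair v w F * pair w t X →
      SemiconjBy c (pair w t X) (pair u v X) := by
    intro X h1 h2
    refine Eq.symm ?_
    calc pair u v X * c
        = (pair u v X * pair v w F * pair u v F) * pair w t F * pair v w F := by
          simp only [hc, mul_assoc]
      _ = pair v w F * pair u v F * (pair v w X * pair w t F * pair v w F) := by
          rw [h1]; simp only [mul_assoc]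
      _ = c * pair w t X := by rw [h2]; simp only [hc, mul_assoc]
  have hcR := hswap R left₁ left₂
  have hcF := hswap F braid₁ braid₂
  have hcG : SemiconjBy c (pair w t G) (pair u v G) := by
    have h1 : pair u v G * pair u v F = 1 := by rw [← pair_mul hu hv huv, hGF, pair_one hu hv]
    have h2 : pair w t F * pair w t G = 1 := by rw [← pair_mul hw ht hwt, hFG, pair_one hw ht]
    refine Eq.symm ?_
    calc pair u v G * c = pair u v G * (c * pair w t F) * pair w t G := by
          simp only [mul_assoc, h2, mul_one]
      _ = c * pair w t G := by rw [hcF.eq]; simp only [← mul_assoc, h1, one_mul]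
  have hcR' : c * pair w t R' = pair u v R' * c := by
    simp only [hR', pair_mul hu hv huv, pair_mul hw ht hwt]
    exact (hcF.mul_right ((hcF.mul_right hcR).mul_right hcG)).mul_right hcG
  have hRc : pair w t R * c = c * pair u v R := by
    have : c = pair v w F * pair w t F * (pair u v F * pair v w F) := by
      simp only [hc, mul_assoc]
      rw [← mul_assoc (pair u v F), hfar, mul_assoc]
    rw [this]
    calc _ = (pair w t R * pair v w F * pair w t F) * (pair u v F * pair v w F) := by
          simp only [mul_assoc]
      _ = pair v w F * pair w t F * (pair v w R * pair u v F * pair v w F) := by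
          rw [← right₂]; simp only [mul_assoc]
      _ = _ := by rw [← right₁]; simp only [mul_assoc]
  have htr : expect w D (expect t D c) = pair u v F * pair u v F := by
    have h1 : expect t D c = pair u v F * pair v w F * pair u v F := by
      rw [hc, expect_mul_of_mem_away_right (pair_mem_away hvt hwt F),
        expect_mul_of_mem_away (mul_mem (pair_mem_away hvt hwt F) (pair_mem_away hut hvt F)),
        expect_pair_eq_one hΨ hw ht hwt, mul_one, braid₁]
    rw [h1, expect_mul_of_mem_away_right (pair_mem_away huw hvw F),
      expect_mul_of_mem_away (pair_mem_away huw hvw F), expect_pair_eq_one hΨ hv hw hvw, mul_one]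
  have hcW : c ∈ W := by
    rw [hW, hRc, hcR', expect_mul_of_mem_away_right (pair_mem_away hut hvt R),
      expect_mul_of_mem_away_right (pair_mem_away huw hvw R),
      expect_mul_of_mem_away (pair_mem_away hut hvt R'),
      expect_mul_of_mem_away (pair_mem_away huw hvw R'), htr,
      ← pair_mul hu hv huv, ← pair_mul hu hv huv, ← pair_mul hu hv huv, hR']
    congr 1
    simp only [mul_assoc]
    rw [← mul_assoc G F, hGF, one_mul, hGF, mul_one]
  -- Slicing `c` in the factor `u` replaces `F₁` by an arbitrary operator on the factor `v`.
  have h₁ : ∀ a b, pair v w F * v a b * pair w t F * pair v w F ∈ W := by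
    intro p s
    have : pair v w F * v p s * pair w t F * pair v w F = ∑ x, ∑ f, ∑ g, Ψ (s, f) (p, g) •
        (u x g * c * u f x) := by
      have e : ∀ x f g, u x g * c * u f x =
          pair v w F * (u x g * pair u v F * u f x) * (pair w t F * pair v w F) := by
        intro x f g
        have k1 : u x g * pair v w F = pair v w F * u x g :=
          mul_pair_of_mem_away (huv _ _) (huw _ _) F
        have k2 : u f x * (pair w t F * pair v w F) = pair w t F * pair v w F * u f x := by
          rw [← mul_assoc, mul_pair_of_mem_away (huw _ _) (hut _ _), mul_assoc,
            mul_pair_of_mem_away (huv _ _) (huw _ _), mul_assoc]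
        rw [hc]
        simp only [mul_assoc]
        rw [k2, ← mul_assoc, k1]
        simp only [mul_assoc]
      have e' : ∀ x, ∑ f, ∑ g, Ψ (s, f) (p, g) •
          (pair v w F * (u x g * pair u v F * u f x) * (pair w t F * pair v w F)) =
          pair v w F * (u x x * v p s) * (pair w t F * pair v w F) := by
        intro x
        rw [← unit_eq_sum_slices hΨ hu huv]
        simp only [Finset.sum_mul, Finset.mul_sum, smul_mul_assoc, mul_smul_comm]
      simp only [e, e', ← Finset.sum_mul, ← Finset.mul_sum, hu.sum, one_mul]
      simp only [mul_assoc]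
    rw [this]
    exact Submodule.sum_mem _ fun x _ => Submodule.sum_mem _ fun f _ => Submodule.sum_mem _
      fun g _ => Submodule.smul_mem _ _
      (hmul' _ (hmul _ hcW _ (huw _ _) (hut _ _)) _ (huw _ _) (hut _ _))
  -- Slicing in the factor `v` then replaces both outer `F₂` by arbitrary operators on `w`.
  have h₂ : ∀ a b a' b', w a b * pair w t F * w a' b' ∈ W := by
    intro a b a' b'
    have : w a b * pair w t F * w a' b' = ∑ x, ∑ f', ∑ g', ∑ f, ∑ g,
        (Ψ (b', f') (a', g') * Ψ (b, f) (a, g)) •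
          (v x g * (pair v w F * v f g' * pair w t F * pair v w F) * v f' x) := by
      have e : ∀ x f g f' g', v x g * (pair v w F * v f g' * pair w t F * pair v w F) * v f' x =
          (v x g * pair v w F * v f x) * pair w t F * (v x g' * pair v w F * v f' x) := by
        intro x f g f' g'
        have k : v f g' = v f x * v x g' := by rw [hv.mul, if_pos rfl]
        have k2 : v x g' * pair w t F = pair w t F * v x g' :=
          mul_pair_of_mem_away (hvw _ _) (hvt _ _) F
        rw [k]
        simp only [mul_assoc]
        rw [← mul_assoc (v x g'), k2]
        simp only [mul_assoc]
      have k3 : ∀ x, v x x * w a b * pair w t F * (v x x * w a' b') =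
          v x x * (w a b * pair w t F * w a' b') := by
        intro x
        simp only [mul_assoc]
        rw [← mul_assoc (pair w t F), ← mul_pair_of_mem_away (hvw _ _) (hvt _ _),
          mul_assoc (v x x), ← mul_assoc (w a b), ← mem_away.1 (hwv a b), ← mul_assoc (v x x),
          ← mul_assoc (v x x), hv.mul, if_pos rfl, mul_assoc]
      have k4 : ∀ x, ∑ f', ∑ g', ∑ f, ∑ g, (Ψ (b', f') (a', g') * Ψ (b, f) (a, g)) •
          ((v x g * pair v w F * v f x) * pair w t F * (v x g' * pair v w F * v f' x)) =
          v x x * (w a b * pair w t F * w a' b') := by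
        intro x
        rw [← k3, ← unit_eq_sum_slices hΨ hv hvw, ← unit_eq_sum_slices hΨ hv hvw]
        simp only [Finset.sum_mul, Finset.mul_sum, smul_mul_assoc, mul_smul_comm, Finset.smul_sum,
          smul_smul]
      simp only [e, k4, ← Finset.sum_mul, hv.sum, one_mul]
    rw [this]
    exact Submodule.sum_mem _ fun x _ => Submodule.sum_mem _ fun f' _ => Submodule.sum_mem _
      fun g' _ => Submodule.sum_mem _ fun f _ => Submodule.sum_mem _ fun g _ =>
      Submodule.smul_mem _ _ (hmul' _ (hmul _ (h₁ _ _) _ (hvw _ _) (hvt _ _)) _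
        (hvw _ _) (hvt _ _))
  have h₃ : ∀ x y p s, w x y * t p s ∈ W := by
    intro x y p s
    rw [← unit_eq_sum_slices hΨ hw hwt]
    exact Submodule.sum_mem _ fun f _ => Submodule.sum_mem _ fun g _ => Submodule.smul_mem _ _
      (h₂ _ _ _ _)
  rw [← hW, ← sum_unit_mul_component hw z]
  refine Submodule.sum_mem _ fun a _ => Submodule.sum_mem _ fun b _ => ?_
  rw [← sum_unit_mul_component ht (component w z a b), Finset.mul_sum]
  refine Submodule.sum_mem _ fun a' _ => ?_
  rw [Finset.mul_sum]
  refine Submodule.sum_mem _ fun b' _ => ?_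
  rw [← mul_assoc]
  exact hmul' _ (h₃ _ _ _ _) _
    (component_mem_away_of_comm (unit_mem_away_comm hwt) (component_mem_away hw z a b) a' b')
    (component_mem_away ht _ a' b')

end TraceProperties

/-! ### Antisymmetrizers in Hecke algebras -/

section Antisymmetrizers

variable {K H : Type*} [Field K] [Ring H] [Algebra K H] {q : K} {r : ℕ → H} {m : ℕ}

theorem qNumber_zero (q : K) : qNumber q 0 = 0 := by simp [qNumber]

theorem qNumber_one (q : K) : qNumber q 1 = 1 := by simp [qNumber]

theorem qNumber_succ (q : K) (k : ℕ) : qNumber q (k + 1) = q ^ k + q⁻¹ * qNumber q k := by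
  rw [qNumber, Finset.sum_range_succ', qNumber, Finset.mul_sum, add_comm]
  congr 1
  · simp
  · refine Finset.sum_congr rfl fun j _ => ?_
    rw [show k + 1 - 1 - (j + 1) = k - 1 - j by omega, pow_succ]
    ring

/-- The substitution `q ↦ -q⁻¹`, which exchanges symmetrizers and antisymmetrizers, changes the
`q`-numbers only by a sign. -/
theorem qNumber_neg_inv (q : K) (k : ℕ) :
    qNumber (-q⁻¹) (k + 1) = (-1) ^ k * qNumber q (k + 1) := by
  rw [qNumber, qNumber, ← Finset.sum_range_reflect, Finset.mul_sum]
  refine Finset.sum_congr rfl fun j hj => ?_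
  have hj' : j ≤ k := Nat.lt_succ_iff.1 (Finset.mem_range.1 hj)
  obtain ⟨i, rfl⟩ := Nat.exists_eq_add_of_le hj'
  rw [show j + i + 1 - 1 - (j + i + 1 - 1 - j) = j by omega,
    show j + i + 1 - 1 - j = i by omega, inv_neg, inv_inv, neg_pow, neg_pow q, pow_add]
  ring

/-- The antisymmetrizer on `m` factors, as the image of an element of an abstract Hecke algebra
with generators `r 0, r 1, …`. -/
def heckeAnti (q : K) (r : ℕ → H) : ℕ → H
  | 0 => 1
  | 1 => 1
  | m + 2 => (qNumber q (m + 2))⁻¹ • (heckeAnti q r (m + 1) *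
      (q ^ (m + 1) • 1 - qNumber q (m + 1) • r m) * heckeAnti q r (m + 1))

theorem heckeAnti_mem (A : Subalgebra K H) :
    ∀ m, (∀ l, l + 1 < m → r l ∈ A) → heckeAnti q r m ∈ A
  | 0, _ => one_mem A
  | 1, _ => one_mem A
  | m + 2, h => by
    have ih := heckeAnti_mem A (m + 1) fun l hl => h l (by omega)
    exact A.smul_mem (mul_mem (mul_mem ih (sub_mem (A.smul_mem (one_mem A) _)
      (A.smul_mem (h m (by omega)) _))) ih) _

theorem semiconjBy_heckeAnti {r' : ℕ → H} {c : H} :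
    ∀ m, (∀ l, l + 1 < m → SemiconjBy c (r l) (r' l)) →
      SemiconjBy c (heckeAnti q r m) (heckeAnti q r' m)
  | 0, _ => SemiconjBy.one_right c
  | 1, _ => SemiconjBy.one_right c
  | m + 2, h => by
    have ih := semiconjBy_heckeAnti (m + 1) fun l hl => h l (by omega)
    have h1 : SemiconjBy c (q ^ (m + 1) • 1 - qNumber q (m + 1) • r m)
        (q ^ (m + 1) • 1 - qNumber q (m + 1) • r' m) := by
      have := (h m (by omega)).eq
      simp only [SemiconjBy, mul_sub, sub_mul, mul_smul_comm, smul_mul_assoc, mul_one, one_mul,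
        this]
    have h2 := ((ih.mul_right h1).mul_right ih).eq
    simp only [heckeAnti, SemiconjBy, mul_smul_comm, smul_mul_assoc, h2]

theorem heckeAnti_congr {r' : ℕ → H} (m : ℕ) (h : ∀ l, l + 1 < m → r l = r' l) :
    heckeAnti q r m = heckeAnti q r' m := by
  have := semiconjBy_heckeAnti (q := q) (c := (1 : H)) (r := r) (r' := r') m fun l hl => by
    rw [h l hl]; exact SemiconjBy.one_left _
  simpa [SemiconjBy] using this

theorem map_heckeAnti {H' : Type*} [Ring H'] [Algebra K H'] (ρ : H →ₐ[K] H') {r' : ℕ → H'} :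
    ∀ m, (∀ l, l + 1 < m → ρ (r l) = r' l) → ρ (heckeAnti q r m) = heckeAnti q r' m
  | 0, _ => map_one ρ
  | 1, _ => map_one ρ
  | m + 2, h => by
    have ih := map_heckeAnti ρ (m + 1) fun l hl => h l (by omega)
    simp only [heckeAnti, map_smul, map_mul, map_sub, map_one, ih, h m (by omega)]

/-- The relations of the Hecke algebra on `m` strands, with generators `r 0, …, r (m - 2)`. -/
structure HeckeRelations (q : K) (r : ℕ → H) (m : ℕ) : Prop where
  hecke : ∀ l, l + 1 < m → r l * r l = 1 + (q - q⁻¹) • r l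
  braid : ∀ l, l + 2 < m → r l * r (l + 1) * r l = r (l + 1) * r l * r (l + 1)
  far : ∀ l k, l + 2 ≤ k → k + 1 < m → r l * r k = r k * r l

theorem HeckeRelations.mono {m' : ℕ} (h : HeckeRelations q r m) (hm : m' ≤ m) :
    HeckeRelations q r m' :=
  ⟨fun l hl => h.hecke l (by omega), fun l hl => h.braid l (by omega),
    fun l k hlk hk => h.far l k hlk (by omega)⟩

theorem HeckeRelations.shift (h : HeckeRelations q r (m + 1)) :
    HeckeRelations q (fun l => r (l + 1)) m :=
  ⟨fun l hl => h.hecke _ (by omega), fun l hl => h.braid (l + 1) (by omega),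
    fun l k hlk hk => h.far _ _ (by omega) (by omega)⟩

theorem HeckeRelations.reverse (h : HeckeRelations q r m) :
    HeckeRelations q (fun l => r (m - 2 - l)) m := by
  refine ⟨fun l hl => h.hecke _ (by omega), fun l hl => ?_,
    fun l k hlk hk => (h.far (m - 2 - k) (m - 2 - l) (by omega) (by omega)).symm⟩
  have := h.braid (m - 2 - (l + 1)) (by omega)
  rw [show m - 2 - (l + 1) + 1 = m - 2 - l by omega] at this
  exact this.symm

theorem HeckeRelations.op (h : HeckeRelations q r m) :
    HeckeRelations q (fun l => MulOpposite.op (r l)) m := by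
  refine ⟨fun l hl => ?_, fun l hl => ?_, fun l k hlk hk => ?_⟩
  · rw [← MulOpposite.op_mul, h.hecke l hl]; simp
  · simp only [← MulOpposite.op_mul, ← mul_assoc, h.braid l hl]
  · simp only [← MulOpposite.op_mul, h.far l k hlk hk]

theorem op_heckeAnti : ∀ m, MulOpposite.op (heckeAnti q r m) =
    heckeAnti q (fun l => MulOpposite.op (r l)) m
  | 0 => rfl
  | 1 => rfl
  | m + 2 => by
    simp only [heckeAnti, MulOpposite.op_smul, MulOpposite.op_mul, MulOpposite.op_sub,
      MulOpposite.op_one, op_heckeAnti (m + 1), mul_assoc]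

/-- An element on which every generator acts by `-q⁻¹` is fixed by the antisymmetrizer. -/
theorem heckeAnti_mul_of_absorb (hq : ∀ k, 1 ≤ k → qNumber q k ≠ 0) {y : H} :
    ∀ m, (∀ l, l + 1 < m → r l * y = -q⁻¹ • y) → heckeAnti q r m * y = y
  | 0, _ => one_mul y
  | 1, _ => one_mul y
  | m + 2, h => by
    have ih := heckeAnti_mul_of_absorb hq (m + 1) fun l hl => h l (by omega)
    have h1 : (q ^ (m + 1) • 1 - qNumber q (m + 1) • r m) * y = qNumber q (m + 2) • y := by
      rw [qNumber_succ q (m + 1), sub_mul, smul_mul_assoc, smul_mul_assoc, one_mul,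
        h m (by omega)]
      module
    rw [heckeAnti, smul_mul_assoc, mul_assoc, ih, mul_assoc, h1, mul_smul_comm, ih, smul_smul,
      inv_mul_cancel₀ (hq _ (by omega)), one_smul]

/-- The Yang–Baxter computation behind the absorption property of the antisymmetrizers. -/
theorem hecke_mul_baxterized {s x y : H} (hq : q ≠ 0) (hecke : x * x = 1 + (q - q⁻¹) • x)
    (braid : x * s * x = s * x * s) (hy : s * y = -q⁻¹ • y) (a b : K) :
    x * ((a • 1 - b • s) * ((q * a) • 1 - (a + q⁻¹ * b) • x) * y) =
      -q⁻¹ • ((a • 1 - b • s) * ((q * a) • 1 - (a + q⁻¹ * b) • x) * y) := by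
  have e1 : x * (x * y) = y + (q - q⁻¹) • (x * y) := by
    rw [← mul_assoc, hecke, add_mul, one_mul, smul_mul_assoc]
  have e2 : x * (s * (x * y)) = -q⁻¹ • (s * (x * y)) := by
    rw [← mul_assoc s, ← mul_assoc, ← mul_assoc, braid, mul_assoc, hy, mul_smul_comm, mul_assoc]
  simp only [mul_sub, sub_mul, mul_smul_comm, smul_mul_assoc, mul_one, one_mul, mul_assoc, hy,
    e1, e2, smul_sub, smul_add, smul_smul]
  match_scalars <;> field_simp <;> ring

theorem HeckeRelations.mul_heckeAnti (hq0 : q ≠ 0) (hq : ∀ k, 1 ≤ k → qNumber q k ≠ 0) :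
    ∀ m, HeckeRelations q r m → ∀ l, l + 1 < m →
      r l * heckeAnti q r m = -q⁻¹ • heckeAnti q r m
  | 0, _, l, hl => absurd hl (by omega)
  | 1, _, l, hl => absurd hl (by omega)
  | 2, h, l, hl => by
    obtain rfl : l = 0 := by omega
    simp only [heckeAnti, zero_add, pow_one, qNumber_one, one_smul, one_mul, mul_one,
      mul_smul_comm, mul_sub, h.hecke 0 (by omega)]
    match_scalars <;> field_simp
    ring
  | m + 3, h, l, hl => by
    have ih := mul_heckeAnti hq0 hq (m + 2) (h.mono (by omega))
    by_cases hl' : l + 1 < m + 2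
    · rw [heckeAnti, mul_smul_comm, ← mul_assoc, ← mul_assoc, ih l hl', smul_mul_assoc,
        smul_mul_assoc, smul_comm]
    · obtain rfl : l = m + 1 := by omega
      have hE : heckeAnti q r (m + 1) * heckeAnti q r (m + 2) = heckeAnti q r (m + 2) :=
        heckeAnti_mul_of_absorb hq (m + 1) fun l hl => ih l (by omega)
      have hc : heckeAnti q r (m + 1) * r (m + 1) = r (m + 1) * heckeAnti q r (m + 1) := by
        have := semiconjBy_heckeAnti (q := q) (c := r (m + 1)) (r := r) (r' := r) (m + 1)
          fun l hl => (h.far l (m + 1) (by omega) (by omega)).symm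
        exact this.eq.symm
      have key := hecke_mul_baxterized hq0 (h.hecke (m + 1) (by omega))
        (h.braid m (by omega)).symm (ih m (by omega)) (q ^ (m + 1)) (qNumber q (m + 1))
      rw [← pow_succ', ← qNumber_succ] at key
      set E := heckeAnti q r (m + 1) with hEdef
      set G := heckeAnti q r (m + 2) with hGdef
      have hG : G = (qNumber q (m + 2))⁻¹ •
          (E * (q ^ (m + 1) • 1 - qNumber q (m + 1) • r m) * E) := by
        rw [hGdef, heckeAnti]
      have hcom : E * (q ^ (m + 2) • 1 - qNumber q (m + 2) • r (m + 1)) =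
          (q ^ (m + 2) • 1 - qNumber q (m + 2) • r (m + 1)) * E := by
        simp only [mul_sub, sub_mul, mul_smul_comm, smul_mul_assoc, mul_one, one_mul, hc]
      have hprod : G * (q ^ (m + 2) • 1 - qNumber q (m + 2) • r (m + 1)) * G =
          (qNumber q (m + 2))⁻¹ • (E * ((q ^ (m + 1) • 1 - qNumber q (m + 1) • r m) *
            (q ^ (m + 2) • 1 - qNumber q (m + 2) • r (m + 1)) * G)) := by
        nth_rewrite 1 [hG]
        simp only [smul_mul_assoc, mul_assoc]
        rw [← mul_assoc E (_ - _) G, hcom, mul_assoc _ E G, hE]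
      rw [heckeAnti, ← hGdef, hprod]
      simp only [mul_smul_comm]
      rw [← mul_assoc (r (m + 1)) E, ← hc, mul_assoc E, key, mul_smul_comm]
      simp only [smul_comm (-q⁻¹)]

theorem HeckeRelations.heckeAnti_mul (hq0 : q ≠ 0) (hq : ∀ k, 1 ≤ k → qNumber q k ≠ 0)
    (h : HeckeRelations q r m) {l : ℕ} (hl : l + 1 < m) :
    heckeAnti q r m * r l = -q⁻¹ • heckeAnti q r m := by
  have := mul_heckeAnti hq0 hq m h.op l hl
  rw [← op_heckeAnti, ← MulOpposite.op_mul, ← MulOpposite.op_smul] at this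
  exact MulOpposite.op_injective this

theorem HeckeRelations.heckeAnti_mul_self (hq0 : q ≠ 0) (hq : ∀ k, 1 ≤ k → qNumber q k ≠ 0)
    (h : HeckeRelations q r m) : heckeAnti q r m * heckeAnti q r m = heckeAnti q r m :=
  heckeAnti_mul_of_absorb hq m (mul_heckeAnti hq0 hq m h)

/-- The antisymmetrizer is invariant under reversing the order of the strands: both sides absorb
all the generators from both sides, so that their product is equal to either of them. -/
theorem HeckeRelations.heckeAnti_reverse (hq0 : q ≠ 0) (hq : ∀ k, 1 ≤ k → qNumber q k ≠ 0)
    (h : HeckeRelations q r m) :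
    heckeAnti q (fun l => r (m - 2 - l)) m = heckeAnti q r m := by
  have h1 : heckeAnti q r m * heckeAnti q (fun l => r (m - 2 - l)) m =
      heckeAnti q (fun l => r (m - 2 - l)) m := by
    refine heckeAnti_mul_of_absorb hq m fun l hl => ?_
    have := mul_heckeAnti hq0 hq m h.reverse (m - 2 - l) (by omega)
    simpa only [show m - 2 - (m - 2 - l) = l by omega] using this
  have h2 : heckeAnti q r m * heckeAnti q (fun l => r (m - 2 - l)) m = heckeAnti q r m := by
    apply MulOpposite.op_injective
    rw [MulOpposite.op_mul, op_heckeAnti (r := fun l => r (m - 2 - l))]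
    refine heckeAnti_mul_of_absorb hq m fun l hl => ?_
    rw [← MulOpposite.op_mul, h.heckeAnti_mul hq0 hq (by omega), MulOpposite.op_smul]
  rw [← h1, h2]

/-- The recursion for the antisymmetrizers that peels off the first strand instead of the
last. -/
theorem HeckeRelations.qNumber_smul_heckeAnti_succ (hq0 : q ≠ 0)
    (hq : ∀ k, 1 ≤ k → qNumber q k ≠ 0) (m : ℕ) (h : HeckeRelations q r (m + 1)) :
    qNumber q (m + 1) • heckeAnti q r (m + 1) =
      heckeAnti q (fun l => r (l + 1)) m * (q ^ m • 1 - qNumber q m • r 0) *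
        heckeAnti q (fun l => r (l + 1)) m := by
  cases m with
  | zero => simp [heckeAnti, qNumber_one, qNumber_zero]
  | succ m =>
    have h1 : heckeAnti q (fun l => r (l + 1)) (m + 1) =
        heckeAnti q (fun l => r (m + 2 - 2 - l)) (m + 1) := by
      rw [← h.shift.heckeAnti_reverse hq0 hq]
      refine heckeAnti_congr _ fun l hl => ?_
      congr 1
      omega
    rw [← h.heckeAnti_reverse hq0 hq, h1]
    rw [heckeAnti, smul_smul, mul_inv_cancel₀ (hq _ (by omega)), one_smul]
    simp only [show m + 2 - 2 - m = 0 by omega]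

end Antisymmetrizers

/-! ### The identity in an abstract tower of traces -/

section TraceTower

variable {K H : Type*} [Field K] [Ring H] [Algebra K H]

/-- The operators on `N` tensor factors, with their quantum traces: `A l` consists of the
operators acting trivially on the factor `l`, `E l` is the quantum trace over the factor `l`, and
`f l`, `r l`, `r' l` are `F`, `R` and `F² R F⁻²` acting in the factors `l` and `l + 1`, while
`g l` is the inverse of `f l`. -/
structure TraceTower (N : ℕ) (A : ℕ → Subalgebra K H) (E : ℕ → H →ₗ[K] H)
    (r r' f g : ℕ → H) : Prop where
  left : ∀ l, l < N → ∀ y ∈ A l, ∀ z, E l (y * z) = y * E l z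
  right : ∀ l, l < N → ∀ y ∈ A l, ∀ z, E l (z * y) = E l z * y
  expect_mem : ∀ l, l < N → ∀ z, E l z ∈ A l
  expect_mem_of_mem : ∀ l k, l < N → k < N → ∀ z ∈ A k, E l z ∈ A k
  r_mem : ∀ l k, l + 1 < N → k < N → k ≠ l → k ≠ l + 1 → r l ∈ A k
  r'_mem : ∀ l k, l + 1 < N → k < N → k ≠ l → k ≠ l + 1 → r' l ∈ A k
  f_mem : ∀ l k, l + 1 < N → k < N → k ≠ l → k ≠ l + 1 → f l ∈ A k
  g_mem : ∀ l k, l + 1 < N → k < N → k ≠ l → k ≠ l + 1 → g l ∈ A k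
  r_comm : ∀ l, l + 1 < N → ∀ z, z ∈ A l → z ∈ A (l + 1) → Commute (r l) z
  r'_comm : ∀ l, l + 1 < N → ∀ z, z ∈ A l → z ∈ A (l + 1) → Commute (r' l) z
  f_comm : ∀ l, l + 1 < N → ∀ z, z ∈ A l → z ∈ A (l + 1) → Commute (f l) z
  f_mul_g : ∀ l, l + 1 < N → f l * g l = 1
  g_mul_f : ∀ l, l + 1 < N → g l * f l = 1
  f_braid : ∀ l, l + 2 < N → f l * f (l + 1) * f l = f (l + 1) * f l * f (l + 1)
  compat₁ : ∀ l, l + 2 < N → r l * (f (l + 1) * f l) = f (l + 1) * f l * r (l + 1)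
  compat₂ : ∀ l, l + 2 < N → f l * f (l + 1) * r l = r (l + 1) * (f l * f (l + 1))
  r'_eq : ∀ l, l + 1 < N → r' l = f l * (f l * r l * g l) * g l
  conj : ∀ l, l + 1 < N → ∀ z ∈ A (l + 1), E (l + 1) (f l * z * g l) = E l z
  cyclic : ∀ l, l + 1 < N → ∀ z, E l (E (l + 1) (r l * z)) = E l (E (l + 1) (z * r' l))

/-- The copies `M, F_1 M F_1⁻¹, …` of an element `M`. -/
def copies (f g : ℕ → H) (M : H) : ℕ → H
  | 0 => M
  | l + 1 => f l * copies f g M l * g l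

/-- The ordered product `x j * x (j + 1) * ⋯ * x (j + n - 1)`. -/
def seqProd (x : ℕ → H) (j : ℕ) : ℕ → H
  | 0 => 1
  | n + 1 => seqProd x j n * x (j + n)

/-- The ordered product `x (j + n - 1) * ⋯ * x (j + 1) * x j`. -/
def revProd (x : ℕ → H) (j : ℕ) : ℕ → H
  | 0 => 1
  | n + 1 => x (j + n) * revProd x j n

/-- The composition `E j ∘ E (j + 1) ∘ ⋯ ∘ E (j + n - 1)`: the quantum trace over the factors
`j, …, j + n - 1`. -/
def iterExpect (E : ℕ → H →ₗ[K] H) (j : ℕ) : ℕ → H →ₗ[K] H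
  | 0 => LinearMap.id
  | n + 1 => iterExpect E j n ∘ₗ E (j + n)

theorem seqProd_add (x : ℕ → H) (j m n : ℕ) :
    seqProd x j (m + n) = seqProd x j m * seqProd x (j + m) n := by
  induction n with
  | zero => simp [seqProd]
  | succ n ih => rw [← add_assoc, seqProd, ih, seqProd, mul_assoc, add_assoc j]

theorem seqProd_mem (x : ℕ → H) (j : ℕ) (B : Subalgebra K H) (n : ℕ)
    (h : ∀ l, j ≤ l → l < j + n → x l ∈ B) : seqProd x j n ∈ B := by
  induction n with
  | zero => exact one_mem B
  | succ n ih =>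
    exact mul_mem (ih fun l h1 h2 => h l h1 (by omega)) (h _ (by omega) (by omega))

theorem revProd_mem (x : ℕ → H) (j : ℕ) (B : Subalgebra K H) (n : ℕ)
    (h : ∀ l, j ≤ l → l < j + n → x l ∈ B) : revProd x j n ∈ B := by
  induction n with
  | zero => exact one_mem B
  | succ n ih =>
    exact mul_mem (h _ (by omega) (by omega)) (ih fun l h1 h2 => h l h1 (by omega))

theorem seqProd_mul_revProd (x y : ℕ → H) (j n : ℕ)
    (h : ∀ l, j ≤ l → l < j + n → x l * y l = 1) : seqProd x j n * revProd y j n = 1 := by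
  induction n with
  | zero => exact one_mul 1
  | succ n ih =>
    rw [seqProd, revProd, mul_assoc, ← mul_assoc (x _), h _ (by omega) (by omega), one_mul,
      ih fun l h1 h2 => h l h1 (by omega)]

theorem semiconjBy_seqProd {x y : ℕ → H} {c : H} (j j' n : ℕ)
    (h : ∀ i, i < n → SemiconjBy c (x (j + i)) (y (j' + i))) :
    SemiconjBy c (seqProd x j n) (seqProd y j' n) := by
  induction n with
  | zero => exact SemiconjBy.one_right c
  | succ n ih => exact (ih fun i hi => h i (by omega)).mul_right (h n (by omega))

theorem commute_seqProd {x : ℕ → H} {c : H} (j n : ℕ)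
    (h : ∀ l, j ≤ l → l < j + n → Commute c (x l)) : Commute c (seqProd x j n) :=
  semiconjBy_seqProd j j n fun i hi => h _ (by omega) (by omega)

theorem iterExpect_add (E : ℕ → H →ₗ[K] H) (j m n : ℕ) (z : H) :
    iterExpect E j (m + n) z = iterExpect E j m (iterExpect E (j + m) n z) := by
  induction n generalizing z with
  | zero => rfl
  | succ n ih =>
    rw [← add_assoc, iterExpect, LinearMap.comp_apply, ih, iterExpect, LinearMap.comp_apply,
      add_assoc j]

namespace TraceTower

variable {N : ℕ} {A : ℕ → Subalgebra K H} {E : ℕ → H →ₗ[K] H} {r r' f g : ℕ → H} {M : H}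

section

variable (T : TraceTower N A E r r' f g)
include T

theorem iterExpect_mul (j n : ℕ) (hn : j + n ≤ N) {y : H}
    (hy : ∀ l, j ≤ l → l < j + n → y ∈ A l) (z : H) :
    iterExpect E j n (y * z) = y * iterExpect E j n z := by
  induction n generalizing z with
  | zero => rfl
  | succ n ih =>
    rw [iterExpect, LinearMap.comp_apply, T.left _ (by omega) _ (hy _ (by omega) (by omega)),
      ih (by omega) fun l h1 h2 => hy l h1 (by omega)]
    rfl

theorem iterExpect_mul_right (j n : ℕ) (hn : j + n ≤ N) {y : H}
    (hy : ∀ l, j ≤ l → l < j + n → y ∈ A l) (z : H) :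
    iterExpect E j n (z * y) = iterExpect E j n z * y := by
  induction n generalizing z with
  | zero => rfl
  | succ n ih =>
    rw [iterExpect, LinearMap.comp_apply, T.right _ (by omega) _ (hy _ (by omega) (by omega)),
      ih (by omega) fun l h1 h2 => hy l h1 (by omega)]
    rfl

theorem iterExpect_mem (j n k : ℕ) (hn : j + n ≤ N) (hk : k < N) {z : H}
    (hz : z ∈ A k ∨ j ≤ k ∧ k < j + n) : iterExpect E j n z ∈ A k := by
  induction n generalizing z with
  | zero => exact hz.resolve_right (by omega)
  | succ n ih =>
    refine ih (by omega) ?_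
    rcases hz with hz | hz
    · exact Or.inl (T.expect_mem_of_mem _ _ (by omega) hk _ hz)
    · by_cases h : k = j + n
      · exact Or.inl (h ▸ T.expect_mem _ (by omega) _)
      · exact Or.inr (by omega)

/-- Cyclicity of the quantum trace over the factors `j, …, j + n - 1`. -/
theorem iterExpect_cyclic (j n l : ℕ) (hn : j + n ≤ N) (hj : j ≤ l) (hl : l + 1 < j + n) (z : H) :
    iterExpect E j n (r l * z) = iterExpect E j n (z * r' l) := by
  induction n generalizing z with
  | zero => omega
  | succ n ih =>
    by_cases h : l + 1 < j + n
    · simp only [iterExpect, LinearMap.comp_apply]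
      rw [T.left _ (by omega) _ (T.r_mem _ _ (by omega) (by omega) (by omega) (by omega)),
        T.right _ (by omega) _ (T.r'_mem _ _ (by omega) (by omega) (by omega) (by omega)),
        ih (by omega) h]
    · obtain ⟨n, rfl⟩ : ∃ i, n = i + 1 := ⟨n - 1, by omega⟩
      obtain rfl : l = j + n := by omega
      simp only [iterExpect, LinearMap.comp_apply]
      rw [← add_assoc, T.cyclic _ (by omega)]

/-- Conjugation by `f j * f (j + 1) * ⋯` moves the quantum trace by one factor. -/
theorem iterExpect_conj (j n : ℕ) (hn : j + n < N) {z : H} (hz : z ∈ A (j + n)) :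
    iterExpect E (j + 1) n (seqProd f j n * z * revProd g j n) = iterExpect E j n z := by
  induction n generalizing z with
  | zero => simp [iterExpect, seqProd, revProd]
  | succ n ih =>
    have hS : seqProd f j n ∈ A (j + n + 1) := seqProd_mem _ _ _ _ fun l h1 h2 =>
      T.f_mem _ _ (by omega) (by omega) (by omega) (by omega)
    have hS' : revProd g j n ∈ A (j + n + 1) := revProd_mem _ _ _ _ fun l h1 h2 =>
      T.g_mem _ _ (by omega) (by omega) (by omega) (by omega)
    calc iterExpect E (j + 1) (n + 1) (seqProd f j (n + 1) * z * revProd g j (n + 1))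
        = iterExpect E (j + 1) n (E (j + n + 1)
            (seqProd f j n * (f (j + n) * z * g (j + n)) * revProd g j n)) := by
          rw [iterExpect, LinearMap.comp_apply, show j + 1 + n = j + n + 1 by omega]
          simp only [seqProd, revProd, mul_assoc]
      _ = iterExpect E j (n + 1) z := by
          rw [T.right _ (by omega) _ hS', T.left _ (by omega) _ hS, T.conj (j + n) (by omega) _ hz,
            ih (by omega) (T.expect_mem _ (by omega) _)]
          rfl

theorem mul_g_eq {l : ℕ} (hl : l + 1 < N) {x y : H} (h : x * f l = f l * y) :
    g l * x = y * g l := by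
  calc g l * x = g l * (x * f l) * g l := by
        rw [mul_assoc, mul_assoc x, T.f_mul_g l hl, mul_one]
    _ = y * g l := by rw [h, ← mul_assoc, T.g_mul_f l hl, one_mul]

/-- Far generators commute, and `f l * f (l + 1)` moves `r l` to `r (l + 1)`; hence so does any
longer product of consecutive `f`. -/
theorem semiconjBy_seqProd_r (j n l : ℕ) (hn : j + n < N) (hj : j ≤ l) (hl : l + 1 < j + n) :
    SemiconjBy (seqProd f j n) (r l) (r (l + 1)) := by
  obtain ⟨i, rfl⟩ := Nat.exists_eq_add_of_le hj
  obtain ⟨k, rfl⟩ := Nat.exists_eq_add_of_le (show i + 2 ≤ n by omega)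
  have hf : ∀ a b, a + 2 ≤ b ∨ b + 2 ≤ a → a + 1 < N → b + 1 < N → Commute (r a) (f b) := by
    intro a b hab ha hb
    exact T.r_comm a ha _ (T.f_mem _ _ hb (by omega) (by omega) (by omega))
      (T.f_mem _ _ hb (by omega) (by omega) (by omega))
  rw [seqProd_add, seqProd_add]
  refine SemiconjBy.mul_left (SemiconjBy.mul_left ?_ (y := r (j + i + 1)) ?_) (y := r (j + i)) ?_
  · exact (commute_seqProd _ _ fun b _ _ =>
      hf _ _ (by omega) (by omega) (by omega)).symm
  · have := T.compat₂ (j + i) (by omega)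
    simpa [seqProd, SemiconjBy] using this
  · exact (commute_seqProd _ _ fun b _ _ =>
      hf _ _ (by omega) (by omega) (by omega)).symm

end

/-- `M` acts trivially on all the factors but the first, and satisfies the relation of the
quantum matrix algebra. -/
structure IsQuantumMatrix (N : ℕ) (A : ℕ → Subalgebra K H) (r r' f g : ℕ → H) (M : H) :
    Prop where
  mem : ∀ l, 0 < l → l < N → M ∈ A l
  rel : 1 < N → r 0 * M * (f 0 * M * g 0) = M * (f 0 * M * g 0) * r' 0

section

variable (T : TraceTower N A E r r' f g) (hM : IsQuantumMatrix N A r r' f g M)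
include T hM

theorem copies_mem (k l : ℕ) (hk : k < l) (hl : l < N) : copies f g M k ∈ A l := by
  induction k with
  | zero => exact hM.mem l hk hl
  | succ k ih =>
    exact mul_mem (mul_mem (T.f_mem _ _ (by omega) hl (by omega) (by omega)) (ih (by omega)))
      (T.g_mem _ _ (by omega) hl (by omega) (by omega))

/-- An operator that is moved by `F₂ F₁` commutes with all the copies of `M` further to the
right. -/
theorem commute_copies_of_compat {x : ℕ → H} (l : ℕ)
    (hx : ∀ k, l + 1 < N → k < N → k ≠ l → k ≠ l + 1 → x l ∈ A k)
    (hx' : l + 2 < N → ∀ z, z ∈ A (l + 1) → z ∈ A (l + 2) → Commute (x (l + 1)) z)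
    (hc : l + 2 < N → x l * (f (l + 1) * f l) = f (l + 1) * f l * x (l + 1))
    (k : ℕ) (hk : l + 1 < k) (hkN : k < N) : Commute (x l) (copies f g M k) := by
  induction k, hk using Nat.le_induction with
  | base =>
    have hfg := T.f_mul_g
    have hgf := T.g_mul_f
    have h0 : SemiconjBy (f (l + 1) * f l) (x (l + 1)) (x l) := (hc (by omega)).symm
    have h1 : SemiconjBy (g l * g (l + 1)) (x l) (x (l + 1)) := by
      calc g l * g (l + 1) * x l
          = g l * g (l + 1) * (x l * (f (l + 1) * f l)) * (g l * g (l + 1)) := by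
            simp only [mul_assoc]
            rw [← mul_assoc (f l) (g l), hfg _ (by omega), one_mul, hfg _ (by omega), mul_one]
        _ = x (l + 1) * (g l * g (l + 1)) := by
            rw [hc (by omega)]
            simp only [← mul_assoc]
            rw [mul_assoc (g l), hgf _ (by omega), mul_one, hgf _ (by omega), one_mul]
    have h2 : Commute (x (l + 1)) (copies f g M l) :=
      hx' (by omega) _ (T.copies_mem hM _ _ (by omega) (by omega))
        (T.copies_mem hM _ _ (by omega) (by omega))
    have h3 : copies f g M (l + 2) =
        f (l + 1) * f l * copies f g M l * (g l * g (l + 1)) := by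
      simp only [copies, mul_assoc]
    change x l * copies f g M (l + 2) = copies f g M (l + 2) * x l
    rw [h3, ← mul_assoc (x l), ← mul_assoc (x l), ← h0.eq,
      mul_assoc (f (l + 1) * f l) (x (l + 1)), h2.eq]
    simp only [mul_assoc]
    rw [← h1.eq]
    simp only [mul_assoc]
  | succ k hk ih =>
    have h1 := T.f_comm k (by omega) (x l) (hx _ (by omega) (by omega) (by omega) (by omega))
      (hx _ (by omega) (by omega) (by omega) (by omega))
    have h2 : Commute (x l) (g k) := (T.mul_g_eq (by omega) h1.symm.eq).symm
    exact (h1.symm.mul_right (ih (by omega))).mul_right h2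

theorem f_commute_copies (l k : ℕ) (hlk : k ≠ l) (hlk' : k ≠ l + 1) (hk : k < N)
    (hl : l + 1 < N) : Commute (f l) (copies f g M k) := by
  rcases lt_or_gt_of_ne hlk with h | h
  · exact T.f_comm l hl _ (T.copies_mem hM _ _ h (by omega))
      (T.copies_mem hM _ _ (by omega) (by omega))
  · refine T.commute_copies_of_compat hM l (fun k h1 h2 h3 h4 => T.f_mem _ _ h1 h2 h3 h4)
      (fun h => T.f_comm _ h) (fun h => ?_) k (by omega) hk
    rw [← mul_assoc, T.f_braid l h]

theorem r_commute_copies (l k : ℕ) (hlk : k ≠ l) (hlk' : k ≠ l + 1) (hk : k < N)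
    (hl : l + 1 < N) : Commute (r l) (copies f g M k) := by
  rcases lt_or_gt_of_ne hlk with h | h
  · exact T.r_comm l hl _ (T.copies_mem hM _ _ h (by omega))
      (T.copies_mem hM _ _ (by omega) (by omega))
  · exact T.commute_copies_of_compat hM l (fun k h1 h2 h3 h4 => T.r_mem _ _ h1 h2 h3 h4)
      (fun h => T.r_comm _ h) (T.compat₁ l) k (by omega) hk

theorem r'_commute_copies (l k : ℕ) (hlk : k ≠ l) (hlk' : k ≠ l + 1) (hk : k < N)
    (hl : l + 1 < N) : Commute (r' l) (copies f g M k) := by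
  have h1 := T.f_commute_copies hM l k hlk hlk' hk hl
  have h2 : Commute (g l) (copies f g M k) := T.mul_g_eq hl h1.symm.eq
  rw [T.r'_eq l hl]
  have h3 := T.r_commute_copies hM l k hlk hlk' hk hl
  exact (h1.mul_left ((h1.mul_left h3).mul_left h2)).mul_left h2

theorem f_mul_copies (l : ℕ) (hl : l + 1 < N) :
    f l * copies f g M l = copies f g M (l + 1) * f l := by
  rw [copies, mul_assoc _ (g l), T.g_mul_f l hl, mul_one]

theorem rel_copies (l : ℕ) (hl : l + 1 < N) :
    r l * (copies f g M l * copies f g M (l + 1)) =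
      copies f g M l * copies f g M (l + 1) * r' l := by
  induction l with
  | zero =>
    have := hM.rel hl
    simpa only [copies, mul_assoc] using this
  | succ l ih =>
    have h : IsUnit (f l * f (l + 1)) :=
      IsUnit.mul ⟨⟨f l, g l, T.f_mul_g l (by omega), T.g_mul_f l (by omega)⟩, rfl⟩
        ⟨⟨f (l + 1), g (l + 1), T.f_mul_g _ (by omega), T.g_mul_f _ (by omega)⟩, rfl⟩
    have hr : SemiconjBy (f l * f (l + 1)) (r l) (r (l + 1)) := T.compat₂ l (by omega)
    have hf : SemiconjBy (f l * f (l + 1)) (f l) (f (l + 1)) := by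
      change f l * f (l + 1) * f l = f (l + 1) * (f l * f (l + 1))
      rw [T.f_braid l (by omega), mul_assoc]
    have hg : SemiconjBy (f l * f (l + 1)) (g l) (g (l + 1)) := by
      calc f l * f (l + 1) * g l
          = g (l + 1) * (f (l + 1) * (f l * f (l + 1))) * g l := by
            rw [← mul_assoc (g (l + 1)), T.g_mul_f _ (by omega), one_mul]
        _ = g (l + 1) * (f l * f (l + 1)) := by
            rw [← hf.eq, mul_assoc, mul_assoc _ (f l), T.f_mul_g _ (by omega), mul_one]
    have hr' : SemiconjBy (f l * f (l + 1)) (r' l) (r' (l + 1)) := by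
      rw [T.r'_eq l (by omega), T.r'_eq (l + 1) hl]
      exact (hf.mul_right ((hf.mul_right hr).mul_right hg)).mul_right hg
    have h1 : SemiconjBy (f l * f (l + 1)) (copies f g M l) (copies f g M (l + 1)) :=
      SemiconjBy.mul_left (T.f_mul_copies hM l (by omega))
        (T.f_commute_copies hM (l + 1) l (by omega) (by omega) (by omega) (by omega))
    have h2 : SemiconjBy (f l * f (l + 1)) (copies f g M (l + 1)) (copies f g M (l + 2)) :=
      SemiconjBy.mul_left
        (T.f_commute_copies hM l (l + 2) (by omega) (by omega) (by omega) (by omega))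
        (T.f_mul_copies hM (l + 1) (by omega))
    have e1 := (hr.mul_right (h1.mul_right h2)).eq
    have e2 := ((h1.mul_right h2).mul_right hr').eq
    rw [ih (by omega)] at e1
    exact h.mul_right_cancel (e1.symm.trans e2)

/-- The relation `R_l M_{\bar 1} ⋯ M_{\bar n} = M_{\bar 1} ⋯ M_{\bar n} (F² R F⁻²)_l`. -/
theorem r_mul_copyProd (l n : ℕ) (hl : l + 1 < n) (hn : n ≤ N) :
    r l * seqProd (copies f g M) 0 n = seqProd (copies f g M) 0 n * r' l := by
  obtain ⟨i, rfl⟩ := Nat.exists_eq_add_of_le (show l + 2 ≤ n by omega)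
  have h1 : Commute (r l) (seqProd (copies f g M) 0 l) := commute_seqProd _ _ fun k _ h =>
    T.r_commute_copies hM _ _ (by omega) (by omega) (by omega) (by omega)
  have h2 : Commute (r' l) (seqProd (copies f g M) (0 + (l + 2)) i) :=
    commute_seqProd _ _ fun k _ h =>
      T.r'_commute_copies hM _ _ (by omega) (by omega) (by omega) (by omega)
  have h3 : seqProd (copies f g M) (0 + l) 2 = copies f g M l * copies f g M (l + 1) := by
    simp [seqProd]
  rw [seqProd_add, mul_assoc, ← h2.eq, ← mul_assoc, ← mul_assoc]
  congr 1
  rw [seqProd_add, ← mul_assoc, h1.eq, mul_assoc, h3, T.rel_copies hM l (by omega)]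
  simp only [mul_assoc]

theorem semiconjBy_seqProd_copies (j n l : ℕ) (hn : j + n < N) (hj : j ≤ l) (hl : l < j + n) :
    SemiconjBy (seqProd f j n) (copies f g M l) (copies f g M (l + 1)) := by
  obtain ⟨i, rfl⟩ := Nat.exists_eq_add_of_le hj
  obtain ⟨k, rfl⟩ := Nat.exists_eq_add_of_le (show i + 1 ≤ n by omega)
  rw [seqProd_add, seqProd]
  refine SemiconjBy.mul_left (SemiconjBy.mul_left ?_ (T.f_mul_copies hM (j + i) (by omega)))
    (y := copies f g M (j + i)) ?_
  · exact (commute_seqProd _ _ fun b _ _ =>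
      (T.f_commute_copies hM _ _ (by omega) (by omega) (by omega) (by omega)).symm).symm
  · exact (commute_seqProd _ _ fun b _ _ =>
      (T.f_commute_copies hM _ _ (by omega) (by omega) (by omega) (by omega)).symm).symm

/-- The quantum trace of an operator built from the copies of `M` and of `R` does not depend on
the position: a shift by one factor is the conjugation by `f j * f (j + 1) * ⋯`. -/
theorem iterExpect_heckeAnti_mul_copies (q : K) (j n : ℕ) (hn : j + n ≤ N) :
    iterExpect E j n (heckeAnti q (fun l => r (j + l)) n * seqProd (copies f g M) j n) =
      iterExpect E 0 n (heckeAnti q r n * seqProd (copies f g M) 0 n) := by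
  induction j with
  | zero => simp
  | succ j ih =>
    have hr : SemiconjBy (seqProd f j n) (heckeAnti q (fun l => r (j + l)) n)
        (heckeAnti q (fun l => r (j + 1 + l)) n) := by
      refine semiconjBy_heckeAnti n fun l hl => ?_
      rw [add_right_comm]
      exact T.semiconjBy_seqProd_r j n (j + l) (by omega) (by omega) (by omega)
    have hc : SemiconjBy (seqProd f j n) (seqProd (copies f g M) j n)
        (seqProd (copies f g M) (j + 1) n) := by
      refine semiconjBy_seqProd _ _ _ fun i hi => ?_
      rw [add_right_comm]
      exact T.semiconjBy_seqProd_copies hM j n (j + i) (by omega) (by omega) (by omega)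
    rw [← ih (by omega), ← T.iterExpect_conj j n (by omega), (hr.mul_right hc).eq, mul_assoc,
      seqProd_mul_revProd _ _ _ _ fun l _ _ => T.f_mul_g l (by omega), mul_one]
    exact mul_mem (heckeAnti_mem _ _ fun l hl =>
        T.r_mem _ _ (by omega) (by omega) (by omega) (by omega))
      (seqProd_mem _ _ _ _ fun l _ hl => T.copies_mem hM _ _ hl (by omega))

/-- The product of a power and the trace of an antisymmetrizer is a single trace: the trace of the
antisymmetrizer may be computed in the factors following those of the power. -/
theorem iterExpect_mul_sigma (q : K) (s i : ℕ) (hN : s + 1 + i = N) :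
    iterExpect E 1 s (seqProd r 0 s * seqProd (copies f g M) 0 (s + 1)) *
        iterExpect E 0 i (heckeAnti q r i * seqProd (copies f g M) 0 i) =
      iterExpect E 1 (s + i) (seqProd r 0 s * heckeAnti q (fun l => r (s + 1 + l)) i *
        seqProd (copies f g M) 0 N) := by
  have hσ : ∀ l, 1 ≤ l → l < 1 + s →
      iterExpect E 0 i (heckeAnti q r i * seqProd (copies f g M) 0 i) ∈ A l := by
    intro l _ hl
    refine T.iterExpect_mem 0 i l (by omega) (by omega) ?_
    by_cases h : l < i
    · exact Or.inr (by omega)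
    · refine Or.inl (mul_mem (heckeAnti_mem _ _ fun k hk =>
        T.r_mem _ _ (by omega) (by omega) (by omega) (by omega)) (seqProd_mem _ _ _ _ fun k _ hk =>
        T.copies_mem hM _ _ (by omega) (by omega)))
  have hmem : ∀ l, 1 + s ≤ l → l < 1 + s + i →
      seqProd r 0 s * seqProd (copies f g M) 0 (s + 1) ∈ A l := fun l h1 h2 =>
    mul_mem (seqProd_mem _ _ _ _ fun k _ hk =>
        T.r_mem _ _ (by omega) (by omega) (by omega) (by omega))
      (seqProd_mem _ _ _ _ fun k _ hk => T.copies_mem hM _ _ (by omega) (by omega))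
  have hcomm : SemiconjBy (seqProd (copies f g M) 0 (s + 1))
      (heckeAnti q (fun l => r (s + 1 + l)) i) (heckeAnti q (fun l => r (s + 1 + l)) i) :=
    semiconjBy_heckeAnti i fun l hl => (commute_seqProd _ _ fun k _ hk =>
      T.r_commute_copies hM _ _ (by omega) (by omega) (by omega) (by omega)).symm
  have hsplit : seqProd r 0 s * heckeAnti q (fun l => r (s + 1 + l)) i *
        seqProd (copies f g M) 0 N =
      seqProd r 0 s * seqProd (copies f g M) 0 (s + 1) *
        (heckeAnti q (fun l => r (s + 1 + l)) i * seqProd (copies f g M) (s + 1) i) := by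
    rw [← hN, seqProd_add, zero_add, mul_assoc, ← mul_assoc (heckeAnti _ _ _), ← hcomm.eq]
    simp only [mul_assoc]
  rw [hsplit, iterExpect_add, T.iterExpect_mul _ _ (by omega) hmem, add_comm 1 s,
    T.iterExpect_heckeAnti_mul_copies hM q (s + 1) i (by omega),
    T.iterExpect_mul_right _ _ (by omega) hσ]

/-- The Cayley–Hamilton–Newton identity for the antisymmetrizers. The recursion that peels off
the first strand, cyclicity of the trace and idempotence express the trace of
`R_1 ⋯ R_s` times the antisymmetrizer on the last `i + 1` factors through the same
quantity with `i` replaced by `i - 1`; the identity follows by unrolling. -/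
theorem qNumber_smul_iterExpect_heckeAnti {q : K} (hq0 : q ≠ 0)
    (hq : ∀ k, 1 ≤ k → qNumber q k ≠ 0) (hr : HeckeRelations q r N) (m : ℕ) (hm : m + 1 = N) :
    qNumber q N • iterExpect E 1 m (heckeAnti q r N * seqProd (copies f g M) 0 N) =
      ∑ i ∈ Finset.range N, ((-1) ^ (m - i) * q ^ i) •
        (iterExpect E 1 (m - i) (seqProd r 0 (m - i) *
            seqProd (copies f g M) 0 (m - i + 1)) *
          iterExpect E 0 i (heckeAnti q r i * seqProd (copies f g M) 0 i)) := by
  let φ : H →ₗ[K] H := iterExpect E 1 m ∘ₗ LinearMap.mulRight K (seqProd (copies f g M) 0 N)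
  have hφ : ∀ y, φ y = iterExpect E 1 m (y * seqProd (copies f g M) 0 N) := fun y => rfl
  let B : Subalgebra K H :=
    { carrier := {b | ∀ y, φ (y * b) = φ (b * y)}
      mul_mem' := fun {a b} ha hb y => by
        rw [← mul_assoc, hb, ← mul_assoc, ha, mul_assoc]
      add_mem' := fun {a b} ha hb y => by
        rw [mul_add, add_mul, map_add, map_add, ha, hb]
      algebraMap_mem' := fun c y => by rw [Algebra.commutes] }
  have hB : ∀ l, 1 ≤ l → l + 1 < N → r l ∈ B := by
    intro l h1 h2 y
    rw [hφ, hφ, mul_assoc y, T.r_mul_copyProd hM l N h2 le_rfl, ← mul_assoc, mul_assoc (r l),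
      T.iterExpect_cyclic 1 m l (by omega) h1 (by omega)]
  have hstep : ∀ s i, s + i = m →
      qNumber q (i + 1) • φ (seqProd r 0 s * heckeAnti q (fun l => r (s + l)) (i + 1)) =
        q ^ i • φ (seqProd r 0 s * heckeAnti q (fun l => r (s + 1 + l)) i) -
        qNumber q i • φ (seqProd r 0 (s + 1) * heckeAnti q (fun l => r (s + 1 + l)) i) := by
    intro s i hs
    have hr' : HeckeRelations q (fun l => r (s + l)) (i + 1) :=
      ⟨fun l hl => hr.hecke _ (by omega), fun l hl => hr.braid (s + l) (by omega),
        fun l k hlk hk => hr.far _ _ (by omega) (by omega)⟩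
    have hrec := hr'.qNumber_smul_heckeAnti_succ hq0 hq i
    have hsh : (fun l => r (s + (l + 1))) = fun l => r (s + 1 + l) := by
      funext l; congr 1; omega
    have hid := hr'.shift.heckeAnti_mul_self hq0 hq
    rw [hsh] at hrec hid
    set a := heckeAnti q (fun l => r (s + 1 + l)) i with ha
    have haB : a ∈ B := heckeAnti_mem _ _ fun l hl => hB _ (by omega) (by omega)
    have hcomm : a * seqProd r 0 s = seqProd r 0 s * a := by
      refine (semiconjBy_heckeAnti i fun l hl => ?_ : SemiconjBy (seqProd r 0 s) a a).eq.symm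
      exact (commute_seqProd _ _ fun k _ hk =>
        (hr.far k (s + 1 + l) (by omega) (by omega)).symm).symm
    rw [← map_smul, ← mul_smul_comm, hrec, ← mul_assoc, haB, ← mul_assoc, ← mul_assoc, hcomm,
      mul_assoc (seqProd r 0 s) a a, hid, mul_sub, map_sub]
    congr 1
    · rw [mul_smul_comm, mul_one, map_smul]
    · rw [mul_smul_comm, map_smul, seqProd, haB, ← mul_assoc, hcomm, add_zero, zero_add]
  have hsum : ∀ i, i ≤ m →
      qNumber q (i + 1) • φ (seqProd r 0 (m - i) *
          heckeAnti q (fun l => r (m - i + l)) (i + 1)) =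
        ∑ j ∈ Finset.range (i + 1), ((-1) ^ (i - j) * q ^ j) •
          φ (seqProd r 0 (m - j) * heckeAnti q (fun l => r (m - j + 1 + l)) j) := by
    intro i hi
    induction i with
    | zero => simp [qNumber_one, heckeAnti]
    | succ i ih =>
      rw [hstep _ _ (by omega), show m - (i + 1) + 1 = m - i by omega, ih (by omega),
        Finset.sum_range_succ _ (i + 1), sub_eq_neg_add, ← Finset.sum_neg_distrib]
      congr 1
      · refine Finset.sum_congr rfl fun j hj => ?_
        have := Finset.mem_range.1 hj
        rw [show i + 1 - j = i - j + 1 by omega, pow_succ]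
        module
      · simp [show m - (i + 1) + 1 = m - i by omega]
  have h := hsum m le_rfl
  simp only [Nat.sub_self, seqProd, one_mul, zero_add] at h
  rw [hφ, hm] at h
  rw [h]
  refine Finset.sum_congr rfl fun i hi => ?_
  have := Finset.mem_range.1 hi
  rw [hφ, T.iterExpect_mul_sigma hM q (m - i) i (by omega), Nat.sub_add_cancel (by omega)]

end

end TraceTower

end TraceTower

/-! ### Operators on tensor powers as matrices -/

section SiteUnits

variable {K ι S σ τ : Type*} [Field K] [Fintype ι] [DecidableEq ι] [Ring S] [Algebra K S]
  [Fintype σ] [DecidableEq σ] [Fintype τ] [DecidableEq τ]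

/-- The matrix unit `E_{ab}` acting in the tensor factor `l`. -/
def siteUnit (S : Type*) [Ring S] (l : σ) (a b : ι) : Matrix (σ → ι) (σ → ι) S :=
  Matrix.of fun x y => if x l = a ∧ y = Function.update x l b then 1 else 0

theorem siteUnit_mul_apply (l : σ) (a b : ι) (Z : Matrix (σ → ι) (σ → ι) S) (x y : σ → ι) :
    (siteUnit S l a b * Z) x y = if x l = a then Z (Function.update x l b) y else 0 := by
  rw [Matrix.mul_apply, Finset.sum_eq_single (Function.update x l b)]
  · simp [siteUnit]
  · intro z _ hz
    simp [siteUnit, hz]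
  · simp

theorem mul_siteUnit_apply (l : σ) (a b : ι) (Z : Matrix (σ → ι) (σ → ι) S) (x y : σ → ι) :
    (Z * siteUnit S l a b) x y = if y l = b then Z x (Function.update y l a) else 0 := by
  rw [Matrix.mul_apply, Finset.sum_eq_single (Function.update y l a)]
  · by_cases h : y l = b
    · simp [siteUnit, ← h]
    · have : y ≠ Function.update y l b := fun e => h (by rw [e, Function.update_self])
      simp [siteUnit, h, this]
  · intro z _ hz
    have : ¬ (z l = a ∧ y = Function.update z l b) := by
      rintro ⟨rfl, rfl⟩
      simp at hz
    simp [siteUnit, this]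
  · simp

theorem isMatrixUnits_siteUnit (l : σ) : IsMatrixUnits (siteUnit (ι := ι) S l) where
  mul a b c d := by
    ext x y
    rw [siteUnit_mul_apply]
    by_cases h : b = c
    · subst h
      by_cases hx : x l = a <;> simp [siteUnit, hx]
    · simp [siteUnit, h]
  sum := by
    ext x y
    rw [Matrix.sum_apply, Finset.sum_eq_single (x l)]
    · simp [siteUnit, Matrix.one_apply, eq_comm]
    · intro a _ ha
      simp [siteUnit, ha.symm]
    · simp

theorem siteUnit_mem_away {l k : σ} (h : l ≠ k) (a b : ι) :
    siteUnit S l a b ∈ away K (siteUnit (ι := ι) S k) := by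
  rw [mem_away]
  intro c d
  ext x y
  rw [siteUnit_mul_apply, siteUnit_mul_apply]
  by_cases h1 : x k = c <;> by_cases h2 : x l = a <;>
    simp [siteUnit, h1, h2, h, h.symm, Function.update_comm h]

theorem pair_siteUnit_apply {l k : σ} (h : l ≠ k) (X : Matrix (ι × ι) (ι × ι) K) (x y : σ → ι) :
    pair (siteUnit S l) (siteUnit S k) X x y =
      if ∀ i, i ≠ l → i ≠ k → x i = y i then algebraMap K S (X (x l, x k) (y l, y k)) else 0 := by
  have key : ∀ a b c d, (siteUnit S l a c * siteUnit S k b d) x y =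
      if x l = a ∧ x k = b ∧ y = Function.update (Function.update x l c) k d then 1 else 0 := by
    intro a b c d
    rw [siteUnit_mul_apply]
    by_cases h1 : x l = a <;> simp [siteUnit, h1, h.symm]
  have key' : ∀ c d, y = Function.update (Function.update x l c) k d ↔
      (∀ i, i ≠ l → i ≠ k → x i = y i) ∧ y l = c ∧ y k = d := by
    intro c d
    constructor
    · rintro rfl
      refine ⟨fun i h1 h2 => by simp [h1, h2], by simp [h], by simp⟩
    · rintro ⟨h1, rfl, rfl⟩
      ext i
      by_cases hk : i = k
      · subst hk; simp
      · by_cases hl : i = l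
        · subst hl; simp [hk]
        · simp [hk, hl, h1 i hl hk]
  simp only [pair, Matrix.sum_apply, Matrix.smul_apply, key, key']
  rw [Finset.sum_eq_single (x l), Finset.sum_eq_single (y l), Finset.sum_eq_single (x k),
    Finset.sum_eq_single (y k)]
  · by_cases h1 : ∀ i, i ≠ l → i ≠ k → x i = y i
    · simp only [if_pos h1]
      rw [if_pos ⟨trivial, trivial, h1, trivial, trivial⟩, Algebra.algebraMap_eq_smul_one]
    · simp [h1]
  · intro d _ hd
    simp [hd.symm]
  · simp
  · intro b _ hb
    simp [hb.symm]
  · simp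
  · intro b _ hb
    simp [hb.symm]
  · simp
  · intro b _ hb
    simp [hb.symm]
  · simp

theorem expect_siteUnit_apply (D : Matrix ι ι K) (l : σ) (Z : Matrix (σ → ι) (σ → ι) S)
    (x y : σ → ι) :
    expect (siteUnit S l) D Z x y = if x l = y l then
      ∑ a, ∑ b, D a b • Z (Function.update x l b) (Function.update y l a) else 0 := by
  simp only [expect_apply, Matrix.sum_apply, Matrix.smul_apply, mul_siteUnit_apply,
    siteUnit_mul_apply]
  by_cases h : x l = y l
  · rw [if_pos h]
    refine Finset.sum_congr rfl fun a _ => Finset.sum_congr rfl fun b _ => ?_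
    rw [Finset.sum_eq_single (y l)]
    · simp [h]
    · intro c _ hc
      simp [hc.symm]
    · simp
  · rw [if_neg h]
    refine Finset.sum_eq_zero fun a _ => Finset.sum_eq_zero fun b _ =>
      Finset.sum_eq_zero fun c _ => ?_
    by_cases hc : y l = c
    · subst hc
      simp [h]
    · simp [hc]

variable (K) in
/-- An operator on the tensor factors `σ`, viewed as an operator on the tensor factors `τ` via an
embedding `e` of the sets of factors. -/
def embed (e : σ ↪ τ) : Matrix (σ → ι) (σ → ι) S →ₐ[K] Matrix (τ → ι) (τ → ι) S :=
  AlgHom.ofLinearMap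
    { toFun := fun X => Matrix.of fun x y =>
        if ∀ l, (∀ i, e i ≠ l) → x l = y l then X (x ∘ e) (y ∘ e) else 0
      map_add' := fun X Y => by
        ext x y
        simp only [Matrix.of_apply, Matrix.add_apply]
        split_ifs <;> simp
      map_smul' := fun s X => by
        ext x y
        simp only [Matrix.of_apply, Matrix.smul_apply, RingHom.id_apply]
        split_ifs <;> simp }
    (by
      ext x y
      simp only [LinearMap.coe_mk, AddHom.coe_mk, Matrix.of_apply, Matrix.one_apply]
      by_cases h : x = y
      · subst h
        simp
      · rw [if_neg h]
        by_cases h1 : ∀ l, (∀ i, e i ≠ l) → x l = y l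
        · rw [if_pos h1, if_neg]
          intro h2
          refine h (funext fun l => ?_)
          by_cases h3 : ∃ i, e i = l
          · obtain ⟨i, rfl⟩ := h3
            exact congrFun h2 i
          · exact h1 l (not_exists.1 h3)
        · rw [if_neg h1])
    (by
      intro X Y
      ext x y
      simp only [LinearMap.coe_mk, AddHom.coe_mk, Matrix.of_apply, Matrix.mul_apply]
      have hoff : ∀ (z : σ → ι) (l : τ), (∀ i, e i ≠ l) → Function.extend e z x l = x l :=
        fun z l hl => Function.extend_apply' z x l (by simpa using hl)
      have hon : ∀ z : σ → ι, Function.extend e z x ∘ e = z := fun z =>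
        Function.extend_comp e.injective z x
      rw [← Fintype.sum_of_injective (fun z : σ → ι => Function.extend e z x)
        (fun z z' h => by rw [← hon z, ← hon z']; exact congrArg (· ∘ e) h)
        (fun z => if ∀ l, (∀ i, e i ≠ l) → x l = y l then
          X (x ∘ e) z * Y z (y ∘ e) else 0)]
      · by_cases h : ∀ l, (∀ i, e i ≠ l) → x l = y l <;> simp [h]
      · intro z hz
        rw [if_neg, zero_mul]
        intro h
        refine hz ⟨z ∘ e, funext fun l => ?_⟩
        by_cases h3 : ∃ i, e i = l
        · obtain ⟨i, rfl⟩ := h3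
          exact e.injective.extend_apply _ _ _
        · simp only [hoff _ l (not_exists.1 h3), h l (not_exists.1 h3)]
      · intro z
        rw [if_pos fun l hl => (hoff z l hl).symm, hon]
        by_cases h : ∀ l, (∀ i, e i ≠ l) → x l = y l
        · rw [if_pos h, if_pos fun l hl => (hoff z l hl).trans (h l hl)]
        · rw [if_neg h, if_neg fun h' => h fun l hl => (hoff z l hl).symm.trans (h' l hl),
            mul_zero])

theorem embed_apply (e : σ ↪ τ) (X : Matrix (σ → ι) (σ → ι) S) (x y : τ → ι) :
    embed K e X x y = if ∀ l, (∀ i, e i ≠ l) → x l = y l then X (x ∘ e) (y ∘ e) else 0 := rfl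

theorem embed_injective [Nonempty σ] (e : σ ↪ τ) :
    Function.Injective (embed K e : Matrix (σ → ι) (σ → ι) S →ₐ[K] _) := by
  intro X Y h
  ext a b
  let c : τ → ι := fun _ => a (Classical.arbitrary σ)
  have := congrFun (congrFun h (Function.extend e a c)) (Function.extend e b c)
  rw [embed_apply, embed_apply, if_pos, if_pos] at this
  · simpa only [Function.extend_comp e.injective] using this
  all_goals
    intro l hl
    rw [Function.extend_apply' _ _ _ (by simpa using hl),
      Function.extend_apply' _ _ _ (by simpa using hl)]

theorem embed_siteUnit (e : σ ↪ τ) (l : σ) (a b : ι) :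
    embed K e (siteUnit S l a b) = siteUnit S (e l) a b := by
  ext x y
  simp only [embed_apply, siteUnit, Matrix.of_apply, Function.comp_apply]
  have : y = Function.update x (e l) b ↔
      (∀ k, (∀ i, e i ≠ k) → x k = y k) ∧ y ∘ e = Function.update (x ∘ e) l b := by
    constructor
    · rintro rfl
      refine ⟨fun k hk => by simp [(hk l).symm], ?_⟩
      exact Function.update_comp_eq_of_injective _ e.injective _ _
    · rintro ⟨h1, h2⟩
      ext k
      by_cases h3 : ∃ i, e i = k
      · obtain ⟨i, rfl⟩ := h3
        have := congrFun h2 i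
        rw [← Function.update_comp_eq_of_injective _ e.injective] at this
        exact this
      · rw [← h1 k (not_exists.1 h3), Function.update_of_ne]
        rintro rfl
        exact h3 ⟨l, rfl⟩
  simp only [this]
  by_cases h : ∀ k, (∀ i, e i ≠ k) → x k = y k
  · simp only [if_pos h]
    exact if_congr (and_congr_right fun _ => (and_iff_right h).symm) rfl rfl
  · rw [if_neg h, if_neg fun h' => h h'.2.1]

theorem embed_pair (e : σ ↪ τ) (l k : σ) (X : Matrix (ι × ι) (ι × ι) K) :
    embed K e (pair (siteUnit S l) (siteUnit S k) X) =
      pair (siteUnit S (e l)) (siteUnit S (e k)) X := by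
  simp only [pair, map_sum, map_smul, map_mul, embed_siteUnit]

theorem embed_expect (e : σ ↪ τ) (l : σ) (D : Matrix ι ι K) (Z : Matrix (σ → ι) (σ → ι) S) :
    embed K e (expect (siteUnit S l) D Z) = expect (siteUnit S (e l)) D (embed K e Z) := by
  simp only [expect_apply, map_sum, map_smul, map_mul, embed_siteUnit]

theorem embed_mem_away (e : σ ↪ τ) (l : σ) {Z : Matrix (σ → ι) (σ → ι) S}
    (hZ : Z ∈ away K (siteUnit (ι := ι) S l)) :
    embed K e Z ∈ away K (siteUnit (ι := ι) S (e l)) := by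
  rw [mem_away] at hZ ⊢
  intro a b
  rw [← embed_siteUnit (K := K), ← map_mul, hZ, map_mul]

theorem embed_scalar (e : σ ↪ τ) (s : S) :
    embed K e (Matrix.scalar (σ → ι) s) = Matrix.scalar (τ → ι) s := by
  have h := congrArg (fun X => X * Matrix.scalar (τ → ι) s)
    (map_one (embed K e : Matrix (σ → ι) (σ → ι) S →ₐ[K] Matrix (τ → ι) (τ → ι) S))
  simp only [one_mul] at h
  rw [← h]
  ext x y
  simp only [Matrix.scalar_apply, Matrix.mul_diagonal, embed_apply, Matrix.diagonal_apply,
    Matrix.one_apply]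
  split_ifs <;> simp

theorem scalar_mem_away (l : σ) (s : S) :
    Matrix.scalar (σ → ι) s ∈ away K (siteUnit (ι := ι) S l) := by
  rw [mem_away]
  intro a b
  ext x y
  simp only [Matrix.scalar_apply, Matrix.mul_diagonal, Matrix.diagonal_mul, siteUnit,
    Matrix.of_apply]
  split_ifs <;> simp

theorem lift_inPair {m : ℕ} (X : Matrix (ι × ι) (ι × ι) K) (j : Fin m) :
    lift S (inPair X j) = pair (siteUnit S j.castSucc) (siteUnit S j.succ) X := by
  ext x y
  rw [pair_siteUnit_apply (Fin.castSucc_lt_succ).ne]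
  simp only [lift, inPair, Matrix.map_apply, Matrix.of_apply]
  split_ifs <;> simp

theorem inFirst_eq_sum {m : ℕ} (M : Matrix ι ι S) :
    (inFirst M : Matrix (Fin (m + 1) → ι) (Fin (m + 1) → ι) S) =
      ∑ a, ∑ b, Matrix.scalar _ (M a b) * siteUnit S 0 a b := by
  ext x y
  simp only [Matrix.sum_apply, Matrix.scalar_apply, Matrix.diagonal_mul, inFirst, siteUnit,
    Matrix.of_apply]
  have key : ∀ b, y = Function.update x 0 b ↔ (∀ l, l ≠ 0 → x l = y l) ∧ y 0 = b := by
    intro b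
    constructor
    · rintro rfl
      exact ⟨fun l hl => by simp [hl], by simp⟩
    · rintro ⟨h, rfl⟩
      ext l
      by_cases hl : l = 0
      · subst hl; simp
      · simp [hl, h l hl]
  simp only [key]
  rw [Finset.sum_eq_single (x 0), Finset.sum_eq_single (y 0)]
  · by_cases h : ∀ l, l ≠ 0 → x l = y l
    · simp only [if_pos h]
      rw [if_pos ⟨trivial, h, trivial⟩, mul_one]
    · simp [h]
  · intro b _ hb
    simp [hb.symm]
  · simp
  · intro b _ hb
    simp [hb.symm]
  · simp

theorem embed_inFirst {m n : ℕ} (e : Fin (m + 1) ↪ Fin (n + 1)) (he : e 0 = 0)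
    (M : Matrix ι ι S) : embed K e (inFirst M) = inFirst M := by
  simp only [inFirst_eq_sum, map_sum, map_mul, embed_scalar, embed_siteUnit, he]

theorem inFirst_mem_away {m : ℕ} (M : Matrix ι ι S) {l : Fin (m + 1)} (hl : l ≠ 0) :
    inFirst M ∈ away K (siteUnit (ι := ι) S l) := by
  rw [inFirst_eq_sum]
  exact Subalgebra.sum_mem _ fun a _ => Subalgebra.sum_mem _ fun b _ =>
    mul_mem (scalar_mem_away l _) (siteUnit_mem_away hl.symm a b)

theorem extendRight_eq_embed {m : ℕ} (X : Matrix (Fin m → ι) (Fin m → ι) S) :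
    extendRight X = embed K Fin.castSuccEmb X := by
  ext x y
  simp only [extendRight, Matrix.of_apply, embed_apply]
  have : (∀ l : Fin (m + 1), (∀ i, Fin.castSuccEmb i ≠ l) → x l = y l) ↔
      x (Fin.last m) = y (Fin.last m) := by
    constructor
    · exact fun h => h _ fun i => (Fin.castSucc_lt_last i).ne
    · intro h l hl
      rcases Fin.eq_castSucc_or_eq_last l with ⟨i, rfl⟩ | rfl
      · exact absurd rfl (hl i)
      · exact h
  simp only [this]
  rfl

variable (S) in
/-- A relation between operators on three factors gives one on any three distinct factors. -/
theorem pair_relation {X Y Z X' Y' Z' : Matrix (ι × ι) (ι × ι) K}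
    (h : inPair X (0 : Fin 2) * inPair Y (1 : Fin 2) * inPair Z (0 : Fin 2) =
      inPair X' (1 : Fin 2) * inPair Y' (0 : Fin 2) * inPair Z' (1 : Fin 2))
    {i j k : σ} (hij : i ≠ j) (hik : i ≠ k) (hjk : j ≠ k) :
    pair (siteUnit S i) (siteUnit S j) X * pair (siteUnit S j) (siteUnit S k) Y *
        pair (siteUnit S i) (siteUnit S j) Z =
      pair (siteUnit S j) (siteUnit S k) X' * pair (siteUnit S i) (siteUnit S j) Y' *
        pair (siteUnit S j) (siteUnit S k) Z' := by
  have hinj : Function.Injective ![i, j, k] := by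
    intro a b hab
    fin_cases a <;> fin_cases b <;> simp_all [eq_comm]
  have h1 : lift S (inPair X (0 : Fin 2)) * lift S (inPair Y (1 : Fin 2)) *
      lift S (inPair Z (0 : Fin 2)) = lift S (inPair X' (1 : Fin 2)) *
      lift S (inPair Y' (0 : Fin 2)) * lift S (inPair Z' (1 : Fin 2)) := by
    simp only [lift, ← Matrix.map_mul, h]
  have h2 := congrArg (embed K (⟨![i, j, k], hinj⟩ : Fin 3 ↪ σ)) h1
  simp only [lift_inPair, map_mul, embed_pair] at h2
  exact h2

end SiteUnits

/-! ### The tower of traces of a tensor power -/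

section SiteTraces

variable {K ι S σ : Type*} [Field K] [Fintype ι] [DecidableEq ι] [Ring S] [Algebra K S]
  [Fintype σ] [DecidableEq σ] {R F Ψ : Matrix (ι × ι) (ι × ι) K}

/-- Conjugation by `F` moves the quantum trace to another factor. The additional factor
`Sum.inr 0` plays the part of the factor `u` in `expect_conj_of_braid`. -/
theorem expect_siteUnit_conj (hF : IsRMatrix F) (hΨ : IsSkewInverse F Ψ) {l k : σ} (h : l ≠ k)
    {Z : Matrix (σ → ι) (σ → ι) S} (hZ : Z ∈ away K (siteUnit (ι := ι) S k)) :
    expect (siteUnit S k) (traceMatrix Ψ) (pair (siteUnit S l) (siteUnit S k) F * Z *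
        pair (siteUnit S l) (siteUnit S k) F⁻¹) =
      expect (siteUnit S l) (traceMatrix Ψ) Z := by
  have hdet := (Matrix.isUnit_iff_isUnit_det F).1 hF.isUnit
  have : Nonempty σ := ⟨l⟩
  let e : σ ↪ σ ⊕ Fin 1 := Function.Embedding.inl
  apply embed_injective (K := K) e
  simp only [embed_expect, map_mul, embed_pair]
  have hel : (Sum.inr 0 : σ ⊕ Fin 1) ≠ e l := by simp [e]
  have hek : (Sum.inr 0 : σ ⊕ Fin 1) ≠ e k := by simp [e]
  have hlk : e l ≠ e k := e.injective.ne h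
  exact expect_conj_of_braid hΨ (isMatrixUnits_siteUnit (Sum.inr 0)) (isMatrixUnits_siteUnit _)
    (isMatrixUnits_siteUnit _) (siteUnit_mem_away hel) (siteUnit_mem_away hek)
    (siteUnit_mem_away hlk) (Matrix.mul_nonsing_inv F hdet) (Matrix.nonsing_inv_mul F hdet)
    (pair_relation S hF.braid hel hek hlk) (embed_mem_away e k hZ)

theorem expect_siteUnit_cyclic (hRF : IsCompatible R F) (hΨ : IsSkewInverse F Ψ) {l k : σ}
    (h : l ≠ k) (Z : Matrix (σ → ι) (σ → ι) S) :
    expect (siteUnit S l) (traceMatrix Ψ) (expect (siteUnit S k) (traceMatrix Ψ)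
        (pair (siteUnit S l) (siteUnit S k) R * Z)) =
      expect (siteUnit S l) (traceMatrix Ψ) (expect (siteUnit S k) (traceMatrix Ψ)
        (Z * pair (siteUnit S l) (siteUnit S k) (F * (F * R * F⁻¹) * F⁻¹))) := by
  have hF := hRF.right_isRMatrix
  have hdet := (Matrix.isUnit_iff_isUnit_det F).1 hF.isUnit
  have : Nonempty σ := ⟨l⟩
  let e : σ ↪ σ ⊕ Fin 2 := Function.Embedding.inl
  apply embed_injective (K := K) e
  simp only [embed_expect, map_mul, embed_pair]
  have h01 : (Sum.inr 0 : σ ⊕ Fin 2) ≠ Sum.inr 1 := by simp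
  have h0l : (Sum.inr 0 : σ ⊕ Fin 2) ≠ e l := by simp [e]
  have h0k : (Sum.inr 0 : σ ⊕ Fin 2) ≠ e k := by simp [e]
  have h1l : (Sum.inr 1 : σ ⊕ Fin 2) ≠ e l := by simp [e]
  have h1k : (Sum.inr 1 : σ ⊕ Fin 2) ≠ e k := by simp [e]
  have hlk : e l ≠ e k := e.injective.ne h
  exact expect_expect_mul_of_braid hΨ (isMatrixUnits_siteUnit (Sum.inr 0))
    (isMatrixUnits_siteUnit (Sum.inr 1)) (isMatrixUnits_siteUnit _) (isMatrixUnits_siteUnit _)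
    (siteUnit_mem_away h01) (siteUnit_mem_away h0l) (siteUnit_mem_away h0k)
    (siteUnit_mem_away h1l) (siteUnit_mem_away h1k) (siteUnit_mem_away hlk)
    (Matrix.mul_nonsing_inv F hdet) (Matrix.nonsing_inv_mul F hdet)
    (pair_relation S hF.braid h01 h0l h1l) (pair_relation S hF.braid h1l h1k hlk)
    (pair_relation S hRF.compat₁ h01 h0l h1l) (pair_relation S hRF.compat₁ h1l h1k hlk)
    (pair_relation S hRF.compat₂ h01 h0l h1l) (pair_relation S hRF.compat₂ h1l h1k hlk) _

end SiteTraces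

section ConcreteTower

variable {K ι S : Type*} [Field K] [Fintype ι] [DecidableEq ι] [Ring S] [Algebra K S]
  {q : K} {R F Ψ : Matrix (ι × ι) (ι × ι) K}

variable (K ι S) in
/-- The operators on `N` factors acting trivially on the factor number `l` (no condition if
`l ≥ N`). -/
def siteAway (N l : ℕ) : Subalgebra K (Matrix (Fin N → ι) (Fin N → ι) S) :=
  if h : l < N then away K (siteUnit S ⟨l, h⟩) else ⊤

variable (S) in
/-- The quantum trace over the factor number `l` (zero if `l ≥ N`). -/
def siteExpect (D : Matrix ι ι K) (N l : ℕ) :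
    Matrix (Fin N → ι) (Fin N → ι) S →ₗ[K] Matrix (Fin N → ι) (Fin N → ι) S :=
  if h : l < N then expect (siteUnit S ⟨l, h⟩) D else 0

variable (S) in
/-- The operator `X` acting in the factors number `l` and `l + 1` (the identity if there are no
such factors). -/
def sitePair (X : Matrix (ι × ι) (ι × ι) K) (N l : ℕ) : Matrix (Fin N → ι) (Fin N → ι) S :=
  if h : l + 1 < N then pair (siteUnit S ⟨l, by omega⟩) (siteUnit S ⟨l + 1, h⟩) X else 1

theorem siteUnit_mem_away_nat {N l k : ℕ} (hl : l < N) (hk : k < N) (h : l ≠ k) (a b : ι) :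
    siteUnit S (⟨l, hl⟩ : Fin N) a b ∈ away K (siteUnit (ι := ι) S (⟨k, hk⟩ : Fin N)) :=
  siteUnit_mem_away (by simpa using h) a b

theorem sitePair_mem (X : Matrix (ι × ι) (ι × ι) K) (N l k : ℕ) (hl : l + 1 < N) (hk : k < N)
    (h : k ≠ l) (h' : k ≠ l + 1) : sitePair S X N l ∈ siteAway K ι S N k := by
  rw [sitePair, siteAway, dif_pos hl, dif_pos hk]
  exact pair_mem_away (siteUnit_mem_away_nat _ _ h.symm) (siteUnit_mem_away_nat _ _ h'.symm) X

theorem sitePair_commute (X : Matrix (ι × ι) (ι × ι) K) (N l : ℕ) (hl : l + 1 < N)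
    (z : Matrix (Fin N → ι) (Fin N → ι) S) (h : z ∈ siteAway K ι S N l)
    (h' : z ∈ siteAway K ι S N (l + 1)) : Commute (sitePair S X N l) z := by
  rw [siteAway, dif_pos (by omega)] at h h'
  rw [sitePair, dif_pos hl]
  exact (mul_pair_of_mem_away h h' X).symm

theorem sitePair_mul (X Y : Matrix (ι × ι) (ι × ι) K) (N l : ℕ) :
    sitePair S (X * Y) N l = sitePair S X N l * sitePair S Y N l := by
  unfold sitePair
  split_ifs with h
  · exact pair_mul (isMatrixUnits_siteUnit _) (isMatrixUnits_siteUnit _)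
      (siteUnit_mem_away_nat _ _ (by omega)) X Y
  · rw [one_mul]

theorem sitePair_one (N l : ℕ) : sitePair S (1 : Matrix (ι × ι) (ι × ι) K) N l = 1 := by
  unfold sitePair
  split_ifs with h
  · exact pair_one (isMatrixUnits_siteUnit _) (isMatrixUnits_siteUnit _)
  · rfl

variable (S) in
theorem sitePair_relation {X Y Z X' Y' Z' : Matrix (ι × ι) (ι × ι) K}
    (h : inPair X (0 : Fin 2) * inPair Y (1 : Fin 2) * inPair Z (0 : Fin 2) =
      inPair X' (1 : Fin 2) * inPair Y' (0 : Fin 2) * inPair Z' (1 : Fin 2))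
    (N l : ℕ) (hl : l + 2 < N) :
    sitePair S X N l * sitePair S Y N (l + 1) * sitePair S Z N l =
      sitePair S X' N (l + 1) * sitePair S Y' N l * sitePair S Z' N (l + 1) := by
  simp only [sitePair, dif_pos hl, dif_pos (show l + 1 < N by omega)]
  exact pair_relation S h (by simp) (by simp [Fin.ext_iff, add_assoc]) (by simp)

/-- The operators on `N` factors satisfy all the properties of a trace tower. -/
theorem traceTower (hRF : IsCompatible R F) (hΨ : IsSkewInverse F Ψ) (N : ℕ) :
    TraceTower N (siteAway K ι S N) (siteExpect S (traceMatrix Ψ) N) (sitePair S R N)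
      (sitePair S (twist (twist R F) F) N) (sitePair S F N) (sitePair S F⁻¹ N) := by
  have hF := hRF.right_isRMatrix
  have hdet := (Matrix.isUnit_iff_isUnit_det F).1 hF.isUnit
  refine ⟨?_, ?_, ?_, ?_, fun l k => sitePair_mem R N l k, fun l k => sitePair_mem _ N l k,
    fun l k => sitePair_mem F N l k, fun l k => sitePair_mem _ N l k,
    fun l => sitePair_commute R N l, fun l => sitePair_commute _ N l,
    fun l => sitePair_commute F N l, ?_, ?_, ?_, ?_, ?_, ?_, ?_, ?_⟩
  · intro l hl y hy z
    rw [siteAway, dif_pos hl] at hy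
    rw [siteExpect, dif_pos hl, expect_mul_of_mem_away hy]
  · intro l hl y hy z
    rw [siteAway, dif_pos hl] at hy
    rw [siteExpect, dif_pos hl, expect_mul_of_mem_away_right hy]
  · intro l hl z
    rw [siteAway, siteExpect, dif_pos hl, dif_pos hl]
    exact expect_mem_away (isMatrixUnits_siteUnit _) z
  · intro l k hl hk z hz
    rw [siteAway, dif_pos hk] at hz ⊢
    rw [siteExpect, dif_pos hl]
    by_cases h : l = k
    · subst h
      exact expect_mem_away (isMatrixUnits_siteUnit _) z
    · exact expect_mem_away_of_comm (siteUnit_mem_away_nat _ _ h) hz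
  · intro l _
    rw [← sitePair_mul, Matrix.mul_nonsing_inv F hdet, sitePair_one]
  · intro l _
    rw [← sitePair_mul, Matrix.nonsing_inv_mul F hdet, sitePair_one]
  · exact sitePair_relation S hF.braid N
  · intro l hl
    rw [← mul_assoc, sitePair_relation S hRF.compat₁ N l hl]
  · intro l hl
    rw [sitePair_relation S hRF.compat₂ N l hl, mul_assoc]
  · intro l _
    simp only [twist, sitePair_mul]
  · intro l hl z hz
    rw [siteAway, dif_pos hl] at hz
    simp only [siteExpect, sitePair, dif_pos hl, dif_pos (show l < N by omega)]
    exact expect_siteUnit_conj hF hΨ (by simp) hz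
  · intro l hl z
    simp only [siteExpect, sitePair, dif_pos hl, dif_pos (show l < N by omega)]
    exact expect_siteUnit_cyclic hRF hΨ (by simp) z

theorem heckeRelations_sitePair (hR : IsHecke q R) (N : ℕ) :
    HeckeRelations q (sitePair S R N) N := by
  refine ⟨fun l hl => ?_, sitePair_relation S hR.isRMatrix.braid N, fun l k hlk hk => ?_⟩
  · have h1 : sitePair S (1 + (q - q⁻¹) • R) N l = 1 + (q - q⁻¹) • sitePair S R N l := by
      rw [← sitePair_one (K := K) (ι := ι) N l]
      simp only [sitePair, dif_pos hl, pair, Matrix.add_apply, Matrix.smul_apply, add_smul,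
        Finset.sum_add_distrib, Finset.smul_sum, smul_smul, smul_eq_mul]
    rw [← sitePair_mul, hR.hecke, h1]
  · exact sitePair_commute R N l (by omega) _
      (sitePair_mem R N k l hk (by omega) (by omega) (by omega))
      (sitePair_mem R N k (l + 1) hk (by omega) (by omega) (by omega))

/-! ### Adding one more factor -/

theorem embed_sitePair (X : Matrix (ι × ι) (ι × ι) K) (N l : ℕ) (hl : l + 1 < N) :
    embed K Fin.castSuccEmb (sitePair S X N l) = sitePair S X (N + 1) l := by
  rw [sitePair, sitePair, dif_pos hl, dif_pos (by omega), embed_pair]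
  rfl

theorem embed_siteExpect (D : Matrix ι ι K) (N l : ℕ) (hl : l < N)
    (Z : Matrix (Fin N → ι) (Fin N → ι) S) :
    embed K Fin.castSuccEmb (siteExpect S D N l Z) =
      siteExpect S D (N + 1) l (embed K Fin.castSuccEmb Z) := by
  rw [siteExpect, siteExpect, dif_pos hl, dif_pos (by omega), embed_expect]
  rfl

theorem embed_iterExpect (D : Matrix ι ι K) (N j n : ℕ) (hn : j + n ≤ N)
    (Z : Matrix (Fin N → ι) (Fin N → ι) S) :
    embed K Fin.castSuccEmb (iterExpect (siteExpect S D N) j n Z) =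
      iterExpect (siteExpect S D (N + 1)) j n (embed K Fin.castSuccEmb Z) := by
  induction n generalizing Z with
  | zero => rfl
  | succ n ih =>
    rw [iterExpect, LinearMap.comp_apply, ih (by omega), embed_siteExpect _ _ _ (by omega)]
    rfl

theorem map_seqProd {H H' : Type*} [Ring H] [Ring H'] [Algebra K H] [Algebra K H']
    (ρ : H →ₐ[K] H') {x : ℕ → H} {y : ℕ → H'} (j n : ℕ)
    (h : ∀ l, j ≤ l → l < j + n → ρ (x l) = y l) : ρ (seqProd x j n) = seqProd y j n := by
  induction n with
  | zero => exact map_one ρ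
  | succ n ih =>
    rw [seqProd, seqProd, map_mul, ih fun l h1 h2 => h l h1 (by omega),
      h _ (by omega) (by omega)]

theorem embed_copies (M : Matrix ι ι S) (m l : ℕ) (hl : l < m + 1) :
    embed K Fin.castSuccEmb
        (copies (sitePair S F (m + 1)) (sitePair S F⁻¹ (m + 1)) (inFirst M) l) =
      copies (sitePair S F (m + 2)) (sitePair S F⁻¹ (m + 2)) (inFirst M) l := by
  induction l with
  | zero => exact embed_inFirst _ rfl M
  | succ l ih =>
    rw [copies, map_mul, map_mul, ih (by omega), embed_sitePair _ _ _ hl,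
      embed_sitePair _ _ _ hl]
    rfl

theorem embed_seqProd_copies (M : Matrix ι ι S) (m n : ℕ) (hn : n ≤ m + 1) :
    embed K Fin.castSuccEmb
        (seqProd (copies (sitePair S F (m + 1)) (sitePair S F⁻¹ (m + 1)) (inFirst M)) 0 n) =
      seqProd (copies (sitePair S F (m + 2)) (sitePair S F⁻¹ (m + 2)) (inFirst M)) 0 n :=
  map_seqProd _ _ _ fun l _ h => embed_copies M m l (by omega)

/-- The quantum trace over the last factor. -/
def traceLast (D : Matrix ι ι K) {n : ℕ}
    (X : Matrix (Fin (n + 1) → ι) (Fin (n + 1) → ι) S) : Matrix (Fin n → ι) (Fin n → ι) S :=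
  Matrix.of fun x y => ∑ a, ∑ b, D a b •
    X (Fin.snoc x b : Fin (n + 1) → ι) (Fin.snoc y a : Fin (n + 1) → ι)

theorem siteExpect_last (D : Matrix ι ι K) (n : ℕ)
    (X : Matrix (Fin (n + 1) → ι) (Fin (n + 1) → ι) S) :
    siteExpect S D (n + 1) n X = embed K Fin.castSuccEmb (traceLast D X) := by
  rw [siteExpect, dif_pos (by omega), ← extendRight_eq_embed]
  ext x y
  have h : ∀ (x : Fin (n + 1) → ι) (b : ι),
      Function.update x (⟨n, by omega⟩ : Fin (n + 1)) b = Fin.snoc (Fin.init x) b := by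
    intro x b
    conv_lhs => rw [← Fin.snoc_init_self x]
    exact Fin.update_snoc_last ..
  rw [expect_siteUnit_apply]
  simp only [h]
  rfl

theorem sum_eq_sum_snoc {X : Type*} [AddCommMonoid X] (n : ℕ) (φ : (Fin (n + 1) → ι) → X) :
    ∑ a, φ a = ∑ a : Fin n → ι, ∑ x : ι, φ (Fin.snoc a x : Fin (n + 1) → ι) := by
  rw [← (Fin.snocEquiv fun _ : Fin (n + 1) => ι).sum_comp, Fintype.sum_prod_type_right]
  rfl

theorem qTrace_traceLast (D : Matrix ι ι K) (n : ℕ)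
    (X : Matrix (Fin (n + 1) → ι) (Fin (n + 1) → ι) S) :
    qTrace D X = qTrace D (traceLast D X) := by
  simp only [qTrace, sum_eq_sum_snoc, traceLast, Matrix.of_apply, Finset.smul_sum, smul_smul,
    Fin.prod_univ_castSucc, Fin.snoc_castSucc, Fin.snoc_last]
  refine Finset.sum_congr rfl fun a _ => ?_
  rw [Finset.sum_comm]

theorem qTraceTail_traceLast (D : Matrix ι ι K) (n : ℕ)
    (X : Matrix (Fin (n + 2) → ι) (Fin (n + 2) → ι) S) :
    qTraceTail D X = qTraceTail D (traceLast D X) := by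
  ext x y
  simp only [qTraceTail, sum_eq_sum_snoc, traceLast, Matrix.of_apply, Finset.smul_sum, smul_smul,
    Fin.prod_univ_castSucc, Fin.snoc_castSucc, Fin.snoc_last, Fin.cons_snoc_eq_snoc_cons]
  refine Finset.sum_congr rfl fun a _ => ?_
  rw [Finset.sum_comm]

theorem iterExpect_eq_scalar_qTrace (D : Matrix ι ι K) (n : ℕ)
    (X : Matrix (Fin n → ι) (Fin n → ι) S) :
    iterExpect (siteExpect S D n) 0 n X = Matrix.scalar _ (qTrace D X) := by
  induction n with
  | zero =>
    ext x y
    obtain rfl : x = y := Subsingleton.elim _ _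
    simp [iterExpect, qTrace, Subsingleton.elim default x]
  | succ n ih =>
    rw [iterExpect, LinearMap.comp_apply, zero_add, siteExpect_last,
      ← embed_iterExpect _ _ _ _ (by omega), ih, embed_scalar, qTrace_traceLast]

theorem iterExpect_eq_inFirst_qTraceTail (D : Matrix ι ι K) (m : ℕ)
    (X : Matrix (Fin (m + 1) → ι) (Fin (m + 1) → ι) S) :
    iterExpect (siteExpect S D (m + 1)) 1 m X = inFirst (qTraceTail D X) := by
  induction m with
  | zero =>
    ext x y
    have h : ∀ z : Fin 1 → ι, z = Fin.cons (z 0) default := fun z => by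
      rw [← Fin.cons_self_tail z]
      exact congrArg _ (Subsingleton.elim _ _)
    have h' : ∀ l : Fin 1, l ≠ 0 → x l = y l := fun l hl => absurd (Subsingleton.elim l 0) hl
    simp only [iterExpect, inFirst, qTraceTail, Matrix.of_apply, if_pos h']
    simp [← h]
  | succ m ih =>
    rw [iterExpect, LinearMap.comp_apply, add_comm 1 m, siteExpect_last,
      ← embed_iterExpect _ _ _ _ (by omega), ih, embed_inFirst _ rfl, qTraceTail_traceLast]

end ConcreteTower

/-! ### Comparison with the powers and the traces of powers -/

section Comparison

variable {K ι S : Type*} [Field K] [Fintype ι] [DecidableEq ι] [Ring S] [Algebra K S]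
  {q : K} {R F Ψ : Matrix (ι × ι) (ι × ι) K}

theorem lift_inPair_eq_sitePair {m : ℕ} (X : Matrix (ι × ι) (ι × ι) K) (j : Fin m) :
    lift S (inPair X j) = sitePair S X (m + 1) j := by
  rw [lift_inPair, sitePair, dif_pos (by omega)]
  rfl

theorem lift_antisymmetrizer (q : K) (R : Matrix (ι × ι) (ι × ι) K) (m : ℕ) :
    lift S (antisymmetrizer q R (m + 1)) = heckeAnti q (sitePair S R (m + 1)) (m + 1) := by
  let L : ∀ n, Matrix (Fin n → ι) (Fin n → ι) K →ₐ[K] Matrix (Fin n → ι) (Fin n → ι) S :=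
    fun n => (Algebra.ofId K S).mapMatrix
  have hL : ∀ n (X : Matrix (Fin n → ι) (Fin n → ι) K), lift S X = L n X := fun n X => rfl
  induction m with
  | zero => simp only [antisymmetrizer, heckeAnti, hL, map_one]
  | succ m ih =>
    have hE : lift S (extendRight (antisymmetrizer q R (m + 1))) =
        heckeAnti q (sitePair S R (m + 2)) (m + 1) := by
      have h1 : lift S (extendRight (antisymmetrizer q R (m + 1))) =
          extendRight (lift S (antisymmetrizer q R (m + 1))) := by
        ext x y
        simp only [lift, extendRight, Matrix.map_apply, Matrix.of_apply]
        split_ifs <;> simp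
      rw [h1, ih, extendRight_eq_embed (K := K)]
      exact map_heckeAnti _ _ fun l hl => embed_sitePair R _ l hl
    have hR := lift_inPair_eq_sitePair (S := S) R (Fin.last m)
    rw [hL] at hE hR ⊢
    simp only [antisymmetrizer, heckeAnti, map_smul, map_mul, map_sub, map_one, hE, hR,
      Fin.val_last]

theorem prod_ofFn_eq_seqProd {H : Type*} [Ring H] (x : ℕ → H) (n : ℕ) :
    (List.ofFn fun j : Fin n => x j).prod = seqProd x 0 n := by
  induction n with
  | zero => rfl
  | succ n ih =>
    rw [List.ofFn_succ', List.concat_eq_append, List.prod_append, seqProd, ← ih]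
    simp

theorem copy_eq_copies (M : Matrix ι ι S) {m : ℕ} (j : Fin (m + 1)) :
    copy F M j = copies (sitePair S F (m + 1)) (sitePair S F⁻¹ (m + 1)) (inFirst M) j := by
  induction j using Fin.induction with
  | zero => rfl
  | succ j ih =>
    have h : copy F M j.succ = lift S (inPair F j) * copy F M j.castSucc * lift S (inPair F⁻¹ j) :=
      Fin.induction_succ ..
    rw [h, ih, lift_inPair_eq_sitePair, lift_inPair_eq_sitePair]
    rfl

theorem copyProd_eq_seqProd (M : Matrix ι ι S) (m : ℕ) :
    copyProd F M m =
      seqProd (copies (sitePair S F (m + 1)) (sitePair S F⁻¹ (m + 1)) (inFirst M)) 0 (m + 1) := by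
  rw [copyProd, ← prod_ofFn_eq_seqProd]
  simp only [copy_eq_copies]

theorem lift_rChain (m : ℕ) :
    lift S (rChain R m) = seqProd (sitePair S R (m + 1)) 0 m := by
  rw [rChain, ← prod_ofFn_eq_seqProd]
  have : lift S (List.ofFn fun j : Fin m => inPair R j).prod =
      ((List.ofFn fun j : Fin m => inPair R j).map (algebraMap K S).mapMatrix).prod :=
    map_list_prod (algebraMap K S).mapMatrix _
  rw [this, List.map_ofFn]
  congr 2
  funext j
  exact lift_inPair_eq_sitePair R j

/-- The trace of the antisymmetrizer on `i` factors does not change when further factors are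
added. -/
theorem iterExpect_eq_scalar_sigma (M : Matrix ι ι S) (m i : ℕ) (hi : i ≤ m + 1) :
    iterExpect (siteExpect S (traceMatrix Ψ) (m + 1)) 0 i
        (heckeAnti q (sitePair S R (m + 1)) i *
          seqProd (copies (sitePair S F (m + 1)) (sitePair S F⁻¹ (m + 1)) (inFirst M)) 0 i) =
      Matrix.scalar _ (sigma q R F Ψ M i) := by
  cases i with
  | zero => simp [iterExpect, heckeAnti, seqProd, sigma]
  | succ i =>
    have hi' : i ≤ m := by omega
    induction m, hi' using Nat.le_induction with
    | base =>
      rw [iterExpect_eq_scalar_qTrace, sigma, lift_antisymmetrizer, copyProd_eq_seqProd]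
    | succ m hm ih =>
      have h := congrArg (embed K Fin.castSuccEmb) (ih (by omega))
      rw [embed_iterExpect _ _ _ _ (by omega), embed_scalar, map_mul,
        embed_seqProd_copies M m _ (by omega),
        map_heckeAnti _ _ fun l hl => embed_sitePair R _ l (by omega)] at h
      exact h

/-- The power `M^{\overline{i+1}}`, computed on any larger number of factors. -/
theorem iterExpect_eq_inFirst_power (M : Matrix ι ι S) (m i : ℕ) (hi : i ≤ m) :
    iterExpect (siteExpect S (traceMatrix Ψ) (m + 1)) 1 i
        (seqProd (sitePair S R (m + 1)) 0 i *
          seqProd (copies (sitePair S F (m + 1)) (sitePair S F⁻¹ (m + 1)) (inFirst M)) 0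
            (i + 1)) =
      inFirst (power R F Ψ M (i + 1)) := by
  induction m, hi using Nat.le_induction with
  | base =>
    rw [iterExpect_eq_inFirst_qTraceTail, power, lift_rChain, copyProd_eq_seqProd]
  | succ m hm ih =>
    have h := congrArg (embed K Fin.castSuccEmb) ih
    rw [embed_iterExpect _ _ _ _ (by omega), embed_inFirst _ rfl, map_mul,
      embed_seqProd_copies M m _ (by omega),
      map_seqProd _ _ _ fun l _ hl => embed_sitePair R _ l (by omega)] at h
    exact h

theorem inFirst_injective (m : ℕ) :
    Function.Injective (inFirst (m := m) : Matrix ι ι S → _) := by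
  intro X Y h
  ext a b
  have := congrFun (congrFun h (Fin.cons a fun _ => a)) (Fin.cons b fun _ => a)
  have h' : ∀ l : Fin (m + 1), l ≠ 0 →
      (Fin.cons a (fun _ => a) : Fin (m + 1) → ι) l =
        (Fin.cons b (fun _ => a) : Fin (m + 1) → ι) l := by
    intro l hl
    obtain ⟨k, rfl⟩ := Fin.exists_succ_eq.2 hl
    simp
  simpa only [inFirst, Matrix.of_apply, if_pos h', Fin.cons_zero] using this

theorem inFirst_mul_scalar (m : ℕ) (M : Matrix ι ι S) (s : S) :
    (inFirst (M * Matrix.scalar ι s) : Matrix (Fin (m + 1) → ι) (Fin (m + 1) → ι) S) =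
      inFirst M * Matrix.scalar _ s := by
  ext x y
  simp only [inFirst, Matrix.of_apply, Matrix.scalar_apply, Matrix.mul_diagonal, ite_mul,
    zero_mul]

theorem inFirst_smul (m : ℕ) (c : K) (M : Matrix ι ι S) :
    (inFirst (c • M) : Matrix (Fin (m + 1) → ι) (Fin (m + 1) → ι) S) = c • inFirst M := by
  ext x y
  simp only [inFirst, Matrix.of_apply, Matrix.smul_apply, smul_ite, smul_zero]

theorem inFirst_sum {α : Type*} (m : ℕ) (s : Finset α) (M : α → Matrix ι ι S) :
    (inFirst (∑ i ∈ s, M i) : Matrix (Fin (m + 1) → ι) (Fin (m + 1) → ι) S) =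
      ∑ i ∈ s, inFirst (M i) := by
  ext x y
  simp only [inFirst, Matrix.of_apply, Matrix.sum_apply]
  split_ifs <;> simp

/-- The relation of the algebra `M(R, F)`, imposed on an arbitrary matrix `M`. -/
def SatisfiesRel (R F : Matrix (ι × ι) (ι × ι) K) (M : Matrix ι ι S) : Prop :=
  lift S (inPair R (0 : Fin 1)) * copy F M (0 : Fin 2) * copy F M (1 : Fin 2) =
    copy F M (0 : Fin 2) * copy F M (1 : Fin 2) *
      lift S (inPair (twist (twist R F) F) (0 : Fin 1))

/-- The relation on two factors, embedded into any larger number of factors. -/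
theorem isQuantumMatrix_inFirst {M : Matrix ι ι S} (hM : SatisfiesRel R F M) (m : ℕ) :
    TraceTower.IsQuantumMatrix (m + 1) (siteAway K ι S (m + 1)) (sitePair S R (m + 1))
      (sitePair S (twist (twist R F) F) (m + 1)) (sitePair S F (m + 1))
      (sitePair S F⁻¹ (m + 1)) (inFirst M) := by
  refine ⟨fun l h1 h2 => ?_, fun h => ?_⟩
  · rw [siteAway, dif_pos h2]
    exact inFirst_mem_away M (by simpa [Fin.ext_iff] using h1.ne')
  · have h0 := congrArg (embed K (Fin.castLEEmb (show 2 ≤ m + 1 by omega))) hM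
    have h1 : copy F M (1 : Fin 2) =
        lift S (inPair F (0 : Fin 1)) * inFirst M * lift S (inPair F⁻¹ (0 : Fin 1)) := rfl
    have h2 : copy F M (0 : Fin 2) = inFirst M := rfl
    have h3 : ∀ X : Matrix (ι × ι) (ι × ι) K, embed K (Fin.castLEEmb (show 2 ≤ m + 1 by omega))
        (lift S (inPair X (0 : Fin 1))) = sitePair S X (m + 1) 0 := by
      intro X
      rw [lift_inPair, embed_pair, sitePair, dif_pos (by omega)]
      rfl
    have h4 : embed K (Fin.castLEEmb (show 2 ≤ m + 1 by omega))
        (inFirst M : Matrix (Fin 2 → ι) (Fin 2 → ι) S) = inFirst M := embed_inFirst _ rfl M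
    rw [h1, h2] at h0
    simpa only [map_mul, h3, h4] using h0

/-- The Cayley–Hamilton–Newton identity for the wedge powers, for an arbitrary matrix that
satisfies the relation of the quantum matrix algebra. -/
theorem qNumber_smul_wedgePower (hRF : IsCompatible R F) (hR : IsHecke q R)
    (hΨ : IsSkewInverse F Ψ) {M : Matrix ι ι S} (hM : SatisfiesRel R F M) (m : ℕ) :
    ((-1 : K) ^ m * qNumber q (m + 1)) • wedgePower q R F Ψ M (m + 1) =
      ∑ i ∈ Finset.range (m + 1), (-q) ^ i •
        (power R F Ψ M (m + 1 - i) * Matrix.scalar ι (sigma q R F Ψ M i)) := by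
  apply inFirst_injective m
  have h := (traceTower (S := S) hRF hΨ (m + 1)).qNumber_smul_iterExpect_heckeAnti
    (isQuantumMatrix_inFirst hM m) hR.q_ne_zero hR.qNumber_ne_zero
    (heckeRelations_sitePair hR (m + 1)) m rfl
  rw [iterExpect_eq_inFirst_qTraceTail, ← lift_antisymmetrizer, ← copyProd_eq_seqProd] at h
  rw [inFirst_smul, mul_smul, wedgePower, h, inFirst_sum, Finset.smul_sum]
  refine Finset.sum_congr rfl fun i hi => ?_
  have hi' : i ≤ m := Nat.lt_succ_iff.1 (Finset.mem_range.1 hi)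
  rw [iterExpect_eq_scalar_sigma M m i (by omega), iterExpect_eq_inFirst_power M m (m - i)
    (by omega), inFirst_smul, inFirst_mul_scalar, smul_smul, show m - i + 1 = m + 1 - i by omega]
  congr 1
  obtain ⟨k, rfl⟩ := Nat.exists_eq_add_of_le hi'
  rw [Nat.add_sub_cancel_left, ← mul_assoc, ← pow_add, neg_pow q]
  congr 1
  rw [show i + k + k = i + 2 * k by omega, pow_add, pow_mul]
  simp

theorem satisfiesRel_genMatrix (R F : Matrix (ι × ι) (ι × ι) K) :
    SatisfiesRel R F (genMatrix R F) := by
  let φ := RingQuot.mkAlgHom K (Rel R F)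
  have hlift : ∀ {n : ℕ} (X : Matrix (Fin n → ι) (Fin n → ι) K),
      φ.mapMatrix (lift (FreeAlgebra K (ι × ι)) X) = lift (Alg R F) X := by
    intro n X
    ext x y
    exact φ.commutes _
  have hfirst : ∀ {n : ℕ}, φ.mapMatrix (inFirst (m := n) (freeMatrix K ι)) =
      inFirst (genMatrix R F) := by
    intro n
    ext x y
    simp only [AlgHom.mapMatrix_apply, Matrix.map_apply, inFirst, Matrix.of_apply, genMatrix]
    split_ifs
    · rfl
    · exact map_zero φ
  have hcopy : ∀ {n : ℕ} (j : Fin (n + 1)), φ.mapMatrix (copy F (freeMatrix K ι) j) =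
      copy F (genMatrix R F) j := by
    intro n j
    induction j using Fin.induction with
    | zero => exact hfirst
    | succ j ih =>
      have h : ∀ {S : Type _} [Ring S] [Algebra K S] (M : Matrix ι ι S), copy F M j.succ =
          lift S (inPair F j) * copy F M j.castSucc * lift S (inPair F⁻¹ j) :=
        fun M => Fin.induction_succ ..
      rw [h, h, map_mul, map_mul, ih, hlift, hlift]
  rw [SatisfiesRel, ← hcopy, ← hcopy, ← hlift, ← hlift]
  simp only [← map_mul]
  ext x y
  exact RingQuot.mkAlgHom_rel K (Rel.entry x y)

/-! ### Symmetrizers -/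

/-- The factors `(-1)^k` in the `q`-numbers at `-q⁻¹` cancel in the recursion. -/
theorem symmetrizer_eq_antisymmetrizer (q : K) (R : Matrix (ι × ι) (ι × ι) K) :
    ∀ m, symmetrizer q R m = antisymmetrizer (-q⁻¹) R m
  | 0 => rfl
  | 1 => rfl
  | m + 2 => by
    have hneg : ((-1 : K) ^ (m + 1))⁻¹ = (-1) ^ (m + 1) := by
      rw [← inv_pow, inv_neg, inv_one]
    have hs : ((-1 : K) ^ (m + 1)) * (-1) ^ (m + 1) = 1 := by
      rw [← mul_pow]; simp
    have hmid : (-q⁻¹) ^ (m + 1) • (1 : Matrix (Fin (m + 2) → ι) (Fin (m + 2) → ι) K) -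
        qNumber (-q⁻¹) (m + 1) • inPair R (Fin.last m) =
        (-1 : K) ^ (m + 1) •
          (q⁻¹ ^ (m + 1) • 1 + qNumber q (m + 1) • inPair R (Fin.last m)) := by
      rw [qNumber_neg_inv, neg_pow q⁻¹, pow_succ (-1 : K) m]
      module
    rw [symmetrizer, antisymmetrizer, symmetrizer_eq_antisymmetrizer q R (m + 1), hmid,
      qNumber_neg_inv, mul_inv, hneg, Matrix.mul_smul, Matrix.smul_mul, smul_smul, mul_right_comm,
      hs, one_mul]

theorem symmPower_eq_wedgePower (q : K) (R F Ψ : Matrix (ι × ι) (ι × ι) K) (M : Matrix ι ι S)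
    (k : ℕ) : symmPower q R F Ψ M k = wedgePower (-q⁻¹) R F Ψ M k := by
  cases k with
  | zero => rfl
  | succ m => rw [symmPower, wedgePower, symmetrizer_eq_antisymmetrizer]

theorem tau_eq_sigma (q : K) (R F Ψ : Matrix (ι × ι) (ι × ι) K) (M : Matrix ι ι S)
    (k : ℕ) : tau q R F Ψ M k = sigma (-q⁻¹) R F Ψ M k := by
  cases k with
  | zero => rfl
  | succ m => rw [tau, sigma, symmetrizer_eq_antisymmetrizer]

theorem IsHecke.neg_inv (h : IsHecke q R) : IsHecke (-q⁻¹) R where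
  isRMatrix := h.isRMatrix
  hecke := by
    rw [h.hecke, inv_neg, inv_inv]
    congr 2
    ring
  q_ne_zero := neg_ne_zero.2 (inv_ne_zero h.q_ne_zero)
  qNumber_ne_zero k hk := by
    obtain ⟨m, rfl⟩ := Nat.exists_eq_add_of_le' hk
    rw [qNumber_neg_inv]
    exact mul_ne_zero (pow_ne_zero _ (neg_ne_zero.2 one_ne_zero)) (h.qNumber_ne_zero _ hk)

end Comparison

end QMA

theorem mainTheorem1 {K ι : Type*} [Field K] [Fintype ι] [DecidableEq ι]
    (q : K) (R F : Matrix (ι × ι) (ι × ι) K) (n : ℕ)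
    (hRF : QMA.IsCompatible R F) (hR : QMA.IsEvenHecke q R n) (hF : QMA.IsClosedRMatrix F)
    (Ψ : Matrix (ι × ι) (ι × ι) K) (hΨ : QMA.IsSkewInverse F Ψ)
    (k : ℕ) (hk : 1 ≤ k) :
    ((-1 : K) ^ (k - 1) * QMA.qNumber q k) • QMA.wedgePower q R F Ψ (QMA.genMatrix R F) k =
      ∑ i ∈ Finset.range k, (-q) ^ i •
        (QMA.power R F Ψ (QMA.genMatrix R F) (k - i) *
          Matrix.scalar ι (QMA.sigma q R F Ψ (QMA.genMatrix R F) i)) ∧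
    QMA.qNumber q k • QMA.symmPower q R F Ψ (QMA.genMatrix R F) k =
      ∑ i ∈ Finset.range k, q⁻¹ ^ i •
        (QMA.power R F Ψ (QMA.genMatrix R F) (k - i) *
          Matrix.scalar ι (QMA.tau q R F Ψ (QMA.genMatrix R F) i)) := by
  obtain ⟨m, rfl⟩ := Nat.exists_eq_add_of_le' hk
  have hrel := QMA.satisfiesRel_genMatrix R F
  refine ⟨QMA.qNumber_smul_wedgePower hRF hR.isHecke hΨ hrel m, ?_⟩
  have h := QMA.qNumber_smul_wedgePower hRF hR.isHecke.neg_inv hΨ hrel m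
  rw [QMA.qNumber_neg_inv, ← mul_assoc, ← mul_pow, neg_mul_neg, one_mul, one_pow, one_mul] at h
  simp only [neg_neg, ← QMA.symmPower_eq_wedgePower, ← QMA.tau_eq_sigma] at h
  exact h
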